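/- For $n\ge 1$ let $\mathcal D_n=\{(z_1,\dots,z_n)\in(\mathbb C^\times)^n:\ z_{k+1}/z_k\notin[0,\infty]\ \text{for all}\ 1\le k<n\}$. For $z\in\mathcal D_n$ put $$J_n(z_1,\dots,z_n)=\frac{z_1+\dots+z_n}{(2\pi i)^{n-1}}\Big(\prod_{j=1}^n\int_{\ell_j}\frac{dt_j}{t_j^2}\,e^{-2\pi i z_j/t_j}\Big)\prod_{j=1}^{n-1}\frac{t_jt_{j+1}}{t_{j+1}-t_j},$$ where $\ell_j=\{t: z_j/t\in -i(0,\infty)\}$ is the ray oriented from $0$ to $\infty$. For $z\in(\mathbb C^\times)^n\setminus\mathcal D_n$ let $J_n(z)$ be the average over all $\tau\in S_n$ of the boundary values $\lim_{\varepsilon\to0^+}J_n(e^{i\varepsilon\tau(1)}z_1,\dots,e^{i\varepsilon\tau(n)}z_n)$ (the arguments lie in $\mathcal D_n$ for all small $\varepsilon>0$). Then the following hold. (0) For $z\in\mathcal D_n$ the integral converges absolutely, and $$J_n(z_1,\dots,z_n)=\frac{\sum_i z_i}{(2\pi i)^n\prod_i z_i}\int_{u_i\ge 0,\ \sum_{i=1}^n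 u_i=1}\frac{du_1\cdots du_{n-1}}{\prod_{i=1}^{n-1}\big(\frac{u_i}{z_i}-\frac{u_{i+1}}{z_{i+1}}\big)},$$ where this integral also converges absolutely. For every $z\in(\mathbb C^\times)^n$ and $\tau\in S_n$ the above boundary value exists. The functions $J_n$ satisfy Joyce's axioms: (a) $J_n$ is homogeneous of degree $0$ on $(\mathbb C^\times)^n$ and holomorphic on $\mathcal D_n$. (b) $J_1=1/(2\pi i)$ and, at every point of $\mathcal D_n$ at which none of the denominators vanishes, $$dJ_n=\sum_{k=1}^{n-1}J_k(z_1,\dots,z_k)\,J_{n-k}(z_{k+1},\dots,z_n)\left[\frac{dz_{k+1}+\dots+dz_n}{z_{k+1}+\dots+z_n}-\frac{dz_1+\dots+dz_k}{z_1+\dots+z_k}\right].$$ (c) For all $n\ge 2$ and all $z\in(\mathbb C^\times)^n$, $\sum_{\sigma\in S_n}J_n(z_{\sigma(1)},\dots,z_{\sigma(n)})=0$. (d) For each $k$, $J_n(z_1,\dots,z_n)=o(1/|z_k|)$ as $z_k\to0$ with the other $z_\ell\in\mathbb C^\times$ fixed. Moreover $\sum_{\sigma\in S_n}\prod_{i=1}^{n-1}\frac{1}{u_{\sigma(i)}-u_{\sigma(i+1)}}=0$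 for all $n\ge2$ and all pairwise distinct $u_1,\dots,u_n\in\mathbb C$. Finally, the $J_n$ are Joyce's functions: any family of functions on $(\mathbb C^\times)^n$, $n\ge1$, that satisfies (a)–(d) coincides with $(J_n)$ on $\mathcal D_n$ for every $n\ge 1$. -/

import Mathlib

open Complex Filter Topology MeasureTheory Asymptotics

noncomputable section

namespace JoyceIntegral

/-- The torus `(ℂ^×)^n`. -/
def torus (n : ℕ) : Set (Fin n → ℂ) := {z | ∀ i, z i ≠ 0}

/-- The domain `D_n`: all `z_i` are nonzero and no quotient `z_{k+1} / z_k` lies on `[0, ∞)`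
(the value `∞` is excluded by `z_k ≠ 0`). -/
def domain (n : ℕ) : Set (Fin n → ℂ) :=
  {z | z ∈ torus n ∧ ∀ i : Fin (n - 1),
    ¬ ∃ r : ℝ, 0 ≤ r ∧ z ⟨i + 1, by omega⟩ / z ⟨i, by omega⟩ = (r : ℂ)}

/-! ### The integrals -/

/-- The integrand `∏_{i=1}^n t_i^{-2} e^{-2πi z_i/t_i} · ∏_{i=1}^{n-1} t_i t_{i+1}/(t_{i+1} - t_i)`. -/
def kernel (n : ℕ) (z t : Fin n → ℂ) : ℂ :=
  (∏ i, exp (-(2 * Real.pi * I) * z i / t i) / t i ^ 2) *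
    ∏ i : Fin (n - 1),
      t ⟨i, by omega⟩ * t ⟨i + 1, by omega⟩ / (t ⟨i + 1, by omega⟩ - t ⟨i, by omega⟩)

/-- The point with parameter `r > 0` of the ray `{t : z / t ∈ -i (0, ∞)} = {i z r : r > 0}`,
which is oriented from `0` to `∞`. -/
def rayPoint (z : ℂ) (r : ℝ) : ℂ := I * z * r

/-- The integrand pulled back to the parameters `r ∈ (0, ∞)^n` of the product of the rays;
the factors `i z_j` come from `dt_j = i z_j dr_j`. -/
def rayIntegrand (n : ℕ) (z : Fin n → ℂ) (r : Fin n → ℝ) : ℂ :=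
  (∏ j, I * z j) * kernel n z (fun j => rayPoint (z j) (r j))

/-- The parameter domain `(0, ∞)^n`. -/
def orthant (n : ℕ) : Set (Fin n → ℝ) := {r | ∀ j, 0 < r j}

/-- The function `J_n` as an integral over the product of the `n` rays. -/
def rayJ (n : ℕ) (z : Fin n → ℂ) : ℂ :=
  (∑ i, z i) / (2 * Real.pi * I) ^ (n - 1) * ∫ r in orthant n, rayIntegrand n z r

/-- The simplex `u_i ≥ 0`, `u_1 + ⋯ + u_n = 1` in the coordinates `u_1, …, u_{n-1}`. -/
def simplex (n : ℕ) : Set (Fin (n - 1) → ℝ) := {u | (∀ i, 0 ≤ u i) ∧ ∑ i, u i ≤ 1}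

/-- The point `(u_1, …, u_n)` with `u_n = 1 - u_1 - ⋯ - u_{n-1}`. -/
def barycentric (n : ℕ) (u : Fin (n - 1) → ℝ) (i : Fin n) : ℝ :=
  if h : (i : ℕ) < n - 1 then u ⟨i, h⟩ else 1 - ∑ j, u j

/-- The integrand `∏_{i=1}^{n-1} (u_i / z_i - u_{i+1} / z_{i+1})^{-1}`. -/
def simplexIntegrand (n : ℕ) (z : Fin n → ℂ) (u : Fin (n - 1) → ℝ) : ℂ :=
  (∏ i : Fin (n - 1),
    ((barycentric n u ⟨i, by omega⟩ : ℂ) / z ⟨i, by omega⟩ -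
      (barycentric n u ⟨i + 1, by omega⟩ : ℂ) / z ⟨i + 1, by omega⟩))⁻¹

/-- The function `J_n` as an integral over the simplex. -/
def simplexJ (n : ℕ) (z : Fin n → ℂ) : ℂ :=
  (∑ i, z i) / ((2 * Real.pi * I) ^ n * ∏ i, z i) * ∫ u in simplex n, simplexIntegrand n z u

/-! ### Values off `D_n`

If `z_{k+1} / z_k` is positive, two consecutive rays coincide and the integrand has a pole on the
domain of integration. The rays are then separated by small rotations, in each of the `n!` possible
orders, and the resulting boundary values are averaged. -/

/-- The tuple `z` with `z_j` rotated by the angle `ε τ(j)`. -/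
def tilt (n : ℕ) (z : Fin n → ℂ) (τ : Equiv.Perm (Fin n)) (ε : ℝ) : Fin n → ℂ :=
  fun j => z j * exp (I * ε * ((τ j : ℕ) : ℂ))

/-- The average of the `n!` boundary values of `rayJ` at `z`. -/
def wallJ (n : ℕ) (z : Fin n → ℂ) : ℂ :=
  (∑ τ : Equiv.Perm (Fin n), limUnder (𝓝[>] (0 : ℝ)) (fun ε => rayJ n (tilt n z τ ε))) /
    (n.factorial : ℂ)

open Classical in
/-- The functions `J_n` on `(ℂ^×)^n`: the ray integral on `D_n`, averaged boundary values off it. -/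
def J (n : ℕ) (z : Fin n → ℂ) : ℂ := if z ∈ domain n then rayJ n z else wallJ n z

/-! ### The axioms -/

/-- The first `k + 1` entries of a tuple. -/
def head {n : ℕ} (k : Fin (n - 1)) (z : Fin n → ℂ) : Fin (k + 1) → ℂ :=
  fun i => z ⟨i, by omega⟩

/-- The remaining `n - (k + 1)` entries of a tuple. -/
def tail {n : ℕ} (k : Fin (n - 1)) (z : Fin n → ℂ) : Fin (n - (k + 1)) → ℂ :=
  fun i => z ⟨k + 1 + i, by omega⟩

/-- The differential of the sum of the first `k + 1` coordinates. -/
def dHead {n : ℕ} (k : Fin (n - 1)) : (Fin n → ℂ) →L[ℂ] ℂ :=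
  ∑ i : Fin (k + 1), ContinuousLinearMap.proj (R := ℂ) (φ := fun _ : Fin n => ℂ) ⟨i, by omega⟩

/-- The differential of the sum of the remaining coordinates. -/
def dTail {n : ℕ} (k : Fin (n - 1)) : (Fin n → ℂ) →L[ℂ] ℂ :=
  ∑ i : Fin (n - (k + 1)),
    ContinuousLinearMap.proj (R := ℂ) (φ := fun _ : Fin n => ℂ) ⟨k + 1 + i, by omega⟩

/-- The right-hand side of the recursion for `d G_n`, a linear form on `ℂ^n`; the index `k` here is
one less than the length of the first block. -/
def recursionForm (G : (n : ℕ) → (Fin n → ℂ) → ℂ) (n : ℕ) (z : Fin n → ℂ) :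
    (Fin n → ℂ) →L[ℂ] ℂ :=
  ∑ k : Fin (n - 1),
    (G (k + 1) (head k z) * G (n - (k + 1)) (tail k z)) •
      ((∑ i, tail k z i)⁻¹ • dTail k - (∑ i, head k z i)⁻¹ • dHead k)

/-- Joyce's axioms for a family of functions `G_n`, `n ≥ 1`, on `(ℂ^×)^n`. -/
structure IsJoyceFamily (G : (n : ℕ) → (Fin n → ℂ) → ℂ) : Prop where
  /-- Homogeneity (of degree zero). -/
  homogeneous : ∀ n, 1 ≤ n → ∀ z ∈ torus n, ∀ c : ℂ, c ≠ 0 → G n (c • z) = G n z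
  /-- Holomorphy on `D_n`. -/
  holomorphic : ∀ n, 1 ≤ n → DifferentiableOn ℂ (G n) (domain n)
  /-- The initial value `G_1 = 1 / (2πi)`. -/
  initial : ∀ z ∈ torus 1, G 1 z = 1 / (2 * Real.pi * I)
  /-- The recursion for `d G_n`, wherever its denominators do not vanish. -/
  recursion : ∀ n, 1 ≤ n → ∀ z ∈ domain n,
    (∀ k : Fin (n - 1), ∑ i, head k z i ≠ 0 ∧ ∑ i, tail k z i ≠ 0) →
      HasFDerivAt (G n) (recursionForm G n z) z
  /-- The symmetrization vanishes. -/
  symmetrization : ∀ n, 2 ≤ n → ∀ z ∈ torus n, ∑ σ : Equiv.Perm (Fin n), G n (z ∘ σ) = 0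
  /-- `G_n(z) = o(1/|z_k|)` as `z_k → 0` with the other entries fixed. -/
  growth : ∀ n, 1 ≤ n → ∀ z ∈ torus n, ∀ k : Fin n,
    (fun w : ℂ => G n (Function.update z k w)) =o[𝓝[≠] (0 : ℂ)] (fun w : ℂ => ‖w‖⁻¹)

end JoyceIntegral

end

noncomputable section

namespace JoyceIntegral

/-! Put `z_j = exp (a_j)` and `t_j = i / x_j` with `x_j = exp (y_j - a_j)`. Up to constants, `J_n`
becomes `∑ z_j` times the integral `K(a, w)` of `exp (-2π ∑ w_j x_j) / ∏ (x_k - x_{k+1})` against `∏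
dx_j`, taken at `w = z`. The point is to let the directions `a` of the rays and the weights `w` vary
independently. The directions range over the tube `lift n`, which is convex and which `exp` maps
onto `D_n`.

Each factor `|x_k - x_{k+1}|` is bounded below by a weighted geometric mean of `|x_k|` and
`|x_{k+1}|`. With suitable weights the factor `|x_j|^{1/n}` survives for every `j` (`norm_core_le`),
which gives absolute convergence and local domination. `K` is then holomorphic in `a`, and it is
invariant under real shifts of `a`, so its derivative in `a` is zero: rays may be rotated as long as
they stay apart and the exponentials decay (`coreIntegral_eq_of_mem_sector`). Hence the directions
can be frozen while `z` moves. This yields holomorphy and the boundary values; rotating the rays to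
uniformly separated directions yields `|J_n| ≤ C |∑ z_j| ∏ |z_j|^{-1/n}`, hence the growth
condition.

For the recursion, `∂/∂w_k - ∂/∂w_{k+1}` inserts `-2π (x_k - x_{k+1})`, which cancels one pole and
splits the integral into a product. These differences and the Euler relation for degree `-1`
determine `d(∑ z_j · K)`. Integrating out the scale `∑ |x_j z_j|` gives the simplex formula. The
symmetrization vanishes already for the integrands, by a rational identity.

For uniqueness, induction on `n` makes the difference of two families constant on the connected set
`D_n`. The symmetrization at a point whose permutations all lie in `D_n` then gives `n!` times this
constant equal to `0`. -/

/-! ### Logarithmic coordinates -/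

/-- The left end of the `i`-th gap between consecutive indices. -/
abbrev lo {n : ℕ} (i : Fin (n - 1)) : Fin n := ⟨i, by omega⟩

/-- The right end of the `i`-th gap between consecutive indices. -/
abbrev hi {n : ℕ} (i : Fin (n - 1)) : Fin n := ⟨i + 1, by omega⟩

/-- The tube of logarithms of points of `domain n`. -/
def lift (n : ℕ) : Set (Fin n → ℂ) :=
  {a | ∀ i : Fin (n - 1), 0 < (a (hi i) - a (lo i)).im ∧ (a (hi i) - a (lo i)).im < 2 * Real.pi}

/-- The integrand in logarithmic coordinates: `x_j = exp (y_j - a_j)` runs over the ray of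
direction `exp (-a_j)`. -/
def core (n : ℕ) (a w : Fin n → ℂ) (y : Fin n → ℝ) : ℂ :=
  (∏ j, exp (y j - a j)) * exp (-(2 * Real.pi) * ∑ j, w j * exp (y j - a j)) *
    ∏ i : Fin (n - 1), (exp (y (lo i) - a (lo i)) - exp (y (hi i) - a (hi i)))⁻¹

/-- The integral of `core`, a function of the directions `a` of the rays and of the weights `w`. -/
def coreIntegral (n : ℕ) (a w : Fin n → ℂ) : ℂ := ∫ y, core n a w y

/-- The two directions differ by an angle of at least `κ`, so each of the two points has distance at
least `sin κ` times its modulus from the ray through the other. The larger modulus dominates every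
weighted geometric mean; the free weight `l` is needed to balance the exponents over all gaps. -/
theorem sin_mul_exp_le_norm_exp_sub_exp {p q : ℂ} {κ l : ℝ} (hκ : 0 ≤ κ) (hκ' : κ ≤ Real.pi / 2)
    (h1 : κ ≤ (p - q).im) (h2 : (p - q).im ≤ 2 * Real.pi - κ) (hl : 0 ≤ l) (hl' : l ≤ 1) :
    Real.sin κ * Real.exp (l * p.re + (1 - l) * q.re) ≤ ‖exp p - exp q‖ := by
  have hpi := Real.pi_pos
  have hcos : Real.cos (p.im - q.im) ≤ Real.cos κ := by
    rw [sub_im] at h1 h2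
    rcases le_total (p.im - q.im) Real.pi with h | h
    · exact Real.cos_le_cos_of_nonneg_of_le_pi hκ h h1
    · rw [← Real.cos_two_pi_sub]
      exact Real.cos_le_cos_of_nonneg_of_le_pi hκ (by linarith) (by linarith)
  have hs : 0 ≤ Real.sin κ := Real.sin_nonneg_of_nonneg_of_le_pi hκ (by linarith)
  have hsq : ‖exp p - exp q‖ ^ 2 = Real.exp p.re ^ 2 + Real.exp q.re ^ 2 -
      2 * Real.exp p.re * Real.exp q.re * Real.cos (p.im - q.im) := by
    rw [← normSq_eq_norm_sq, normSq_apply, sub_re, sub_im, exp_re, exp_re, exp_im, exp_im,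
      Real.cos_sub]
    linear_combination Real.exp p.re ^ 2 * Real.sin_sq_add_cos_sq p.im +
      Real.exp q.re ^ 2 * Real.sin_sq_add_cos_sq q.im
  have hP := Real.exp_pos p.re
  have hQ := Real.exp_pos q.re
  have hsc := Real.sin_sq_add_cos_sq κ
  have key : Real.exp p.re ^ 2 + Real.exp q.re ^ 2 -
      2 * Real.exp p.re * Real.exp q.re * Real.cos κ ≤ ‖exp p - exp q‖ ^ 2 := by
    rw [hsq]
    nlinarith [mul_pos hP hQ]
  -- With `P = exp p.re` and `Q = exp q.re`, the lower bound in `key` equals `(Q - P cos κ)² + (P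
  -- sin κ)²`.
  have hp : Real.sin κ * Real.exp p.re ≤ ‖exp p - exp q‖ := by
    refine abs_le_of_sq_le_sq' ?_ (norm_nonneg _) |>.2
    nlinarith [sq_nonneg (Real.exp q.re - Real.exp p.re * Real.cos κ)]
  have hq : Real.sin κ * Real.exp q.re ≤ ‖exp p - exp q‖ := by
    refine abs_le_of_sq_le_sq' ?_ (norm_nonneg _) |>.2
    nlinarith [sq_nonneg (Real.exp p.re - Real.exp q.re * Real.cos κ)]
  rcases le_total p.re q.re with h | h
  · refine le_trans (mul_le_mul_of_nonneg_left (Real.exp_le_exp.2 ?_) hs) hq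
    nlinarith
  · refine le_trans (mul_le_mul_of_nonneg_left (Real.exp_le_exp.2 ?_) hs) hp
    nlinarith

/-- The sum of the weights `(n - 1 - i) / n`, `(i + 1) / n` at the two ends of the gaps. -/
theorem sum_gap_weights {n : ℕ} (hn : 1 ≤ n) (c : Fin n → ℝ) :
    ∑ i : Fin (n - 1), ((1 - (i + 1) / n) * c (lo i) + (1 - (1 - ((i : ℝ) + 1) / n)) * c (hi i)) =
      ∑ j, (1 - 1 / (n : ℝ)) * c j := by
  obtain ⟨m, rfl⟩ : ∃ m, n = m + 1 := ⟨n - 1, by omega⟩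
  have hm : ((m : ℝ) + 1) ≠ 0 := by positivity
  -- The sum extends to all indices because the weight of the last one is zero; in `h2` it is the
  -- weight of the first one.
  have h1 : ∑ i : Fin m, (1 - ((i : ℝ) + 1) / ((m + 1 : ℕ) : ℝ)) * c i.castSucc =
      ∑ j : Fin (m + 1), (1 - ((j : ℝ) + 1) / ((m + 1 : ℕ) : ℝ)) * c j := by
    rw [Fin.sum_univ_castSucc]
    simp [hm]
  have h2 : ∑ i : Fin m, (1 - (1 - ((i : ℝ) + 1) / ((m + 1 : ℕ) : ℝ))) * c i.succ =
      ∑ j : Fin (m + 1), ((j : ℝ) / ((m + 1 : ℕ) : ℝ)) * c j := by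
    rw [Fin.sum_univ_succ]
    simp
  change ∑ i : Fin m, ((1 - ((i : ℝ) + 1) / ((m + 1 : ℕ) : ℝ)) * c i.castSucc +
    (1 - (1 - ((i : ℝ) + 1) / ((m + 1 : ℕ) : ℝ))) * c i.succ) = _
  rw [Finset.sum_add_distrib, h1, h2, ← Finset.sum_add_distrib]
  refine Finset.sum_congr rfl fun j _ => ?_
  push_cast
  field_simp
  ring

/-- Each gap contributes exponents that add up to `1 - 1/n` per variable. The numerator contributes
exponent `1`, so `exp (y_j / n)` remains, which is integrable at `-∞`, while the exponentials
control `+∞`. -/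
theorem norm_core_le {n : ℕ} (hn : 1 ≤ n) {a w : Fin n → ℂ} {κ : ℝ} (hκ : 0 < κ)
    (hκ' : κ ≤ Real.pi / 2)
    (ha : ∀ i : Fin (n - 1), κ ≤ (a (hi i) - a (lo i)).im ∧
      (a (hi i) - a (lo i)).im ≤ 2 * Real.pi - κ)
    {η : Fin n → ℝ} (hη : ∀ j, η j ≤ (w j * exp (-a j)).re) (y : Fin n → ℝ) :
    ‖core n a w y‖ ≤ (Real.sin κ ^ (n - 1))⁻¹ *
      ∏ j, (Real.exp ((y j - (a j).re) / n) * Real.exp (-(2 * Real.pi * η j) * Real.exp (y j))) := by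
  have hs : 0 < Real.sin κ := Real.sin_pos_of_pos_of_lt_pi hκ (by linarith [Real.pi_pos])
  have hn0 : (0 : ℝ) < n := by exact_mod_cast hn
  have hgap : ∏ i : Fin (n - 1), ‖(exp (y (lo i) - a (lo i)) - exp (y (hi i) - a (hi i)))⁻¹‖ ≤
      (Real.sin κ ^ (n - 1))⁻¹ * Real.exp (-∑ j, (1 - 1 / (n : ℝ)) * (y j - (a j).re)) := by
    rw [← sum_gap_weights hn (fun j => y j - (a j).re), Real.exp_neg, Real.exp_sum, ← mul_inv,
      ← Fin.prod_const, ← Finset.prod_mul_distrib, ← Finset.prod_inv_distrib]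
    refine Finset.prod_le_prod (fun _ _ => norm_nonneg _) fun i _ => ?_
    rw [norm_inv]
    have hi' : ((i : ℕ) : ℝ) + 1 ≤ n := by
      have := i.2
      exact_mod_cast (by omega : (i : ℕ) + 1 ≤ n)
    have him : ((y (lo i) - a (lo i)) - (y (hi i) - a (hi i)) : ℂ).im = (a (hi i) - a (lo i)).im := by
      simp only [sub_im, ofReal_im]
      ring
    have := sin_mul_exp_le_norm_exp_sub_exp (p := y (lo i) - a (lo i)) (q := y (hi i) - a (hi i))
      (l := 1 - ((i : ℝ) + 1) / n) hκ.le hκ' (him ▸ (ha i).1) (him ▸ (ha i).2)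
      (by rw [sub_nonneg, div_le_one hn0]; exact hi') (by simp; positivity)
    simp only [sub_re, ofReal_re] at this
    gcongr
  have hexp : ‖exp (-(2 * Real.pi) * ∑ j, w j * exp (y j - a j))‖ ≤
      Real.exp (∑ j, -(2 * Real.pi * η j) * Real.exp (y j)) := by
    rw [norm_exp, Real.exp_le_exp, Finset.mul_sum, re_sum]
    refine Finset.sum_le_sum fun j _ => ?_
    have h1 : -(2 * (Real.pi : ℂ)) * (w j * exp (y j - a j)) =
        ((-(2 * Real.pi) * Real.exp (y j) : ℝ) : ℂ) * (w j * exp (-a j)) := by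
      rw [sub_eq_add_neg, exp_add]
      push_cast
      ring
    rw [h1, re_ofReal_mul]
    have := hη j
    have h2 : 0 < 2 * Real.pi * Real.exp (y j) := by positivity
    nlinarith
  rw [core, norm_mul, norm_mul, norm_prod, norm_prod]
  calc _ ≤ (∏ j, Real.exp (y j - (a j).re)) *
        Real.exp (∑ j, -(2 * Real.pi * η j) * Real.exp (y j)) *
        ((Real.sin κ ^ (n - 1))⁻¹ * Real.exp (-∑ j, (1 - 1 / (n : ℝ)) * (y j - (a j).re))) := by
        gcongr with j
        rw [norm_exp]
        simp
    _ = _ := by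
        rw [Finset.prod_mul_distrib, ← Real.exp_sum, ← Real.exp_sum, ← Real.exp_sum]
        rw [mul_left_comm, mul_right_comm, ← Real.exp_add]
        congr 3
        rw [← sub_eq_add_neg, ← Finset.sum_sub_distrib]
        refine Finset.sum_congr rfl fun j _ => ?_
        field_simp
        ring

/-- The substitution `x = exp y` turns this into a Gamma integral. -/
theorem integrable_exp_mul_exp_neg_exp {p η : ℝ} (hp : 0 < p) (hη : 0 < η) :
    Integrable (fun y : ℝ => Real.exp (p * y) * Real.exp (-η * Real.exp y)) := by
  have h := integrableOn_rpow_mul_exp_neg_mul_rpow (p := 1) (s := p - 1) (b := η) (by linarith)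
    one_pos hη
  have h2 := integrableOn_image_iff_integrableOn_abs_deriv_smul (s := Set.univ) (f := Real.exp)
    (f' := Real.exp) MeasurableSet.univ (fun x _ => (Real.hasDerivAt_exp x).hasDerivWithinAt)
    Real.exp_injective.injOn (fun x : ℝ => x ^ (p - 1) * Real.exp (-η * x ^ (1 : ℝ)))
  rw [Set.image_univ, Real.range_exp] at h2
  have h3 := (integrableOn_univ.1 (h2.1 h))
  refine h3.congr (ae_of_all _ fun y => ?_)
  simp only [abs_of_pos (Real.exp_pos y), smul_eq_mul, Real.rpow_one, ← Real.exp_mul]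
  rw [← mul_assoc, ← Real.exp_add]
  ring_nf

/-- The function that dominates `core`. -/
theorem integrable_prod_exp {n : ℕ} (hn : 1 ≤ n) (c : Fin n → ℝ) {η : Fin n → ℝ}
    (hη : ∀ j, 0 < η j) :
    Integrable (fun y : Fin n → ℝ =>
      ∏ j, (Real.exp ((y j - c j) / n) * Real.exp (-(2 * Real.pi * η j) * Real.exp (y j)))) := by
  have hn0 : (0 : ℝ) < n := by exact_mod_cast hn
  refine Integrable.fintype_prod (f := fun j (y : ℝ) =>
    Real.exp ((y - c j) / n) * Real.exp (-(2 * Real.pi * η j) * Real.exp y)) fun j => ?_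
  have := (integrable_exp_mul_exp_neg_exp (p := 1 / n) (η := 2 * Real.pi * η j) (by positivity)
    (by have := hη j; positivity)).const_mul (Real.exp (-c j / n))
  refine this.congr (ae_of_all _ fun y => ?_)
  simp only
  rw [← mul_assoc, ← Real.exp_add]
  ring_nf

/-! ### Holomorphic integrals depending on parameters -/

/-- Cauchy's estimate on each complex line through `x`. -/
theorem norm_fderiv_le_of_forall_ball {E : Type*} [NormedAddCommGroup E] [NormedSpace ℂ E]
    {f : E → ℂ} {x : E} {r C : ℝ} (hr : 0 < r) (hd : ∀ z ∈ Metric.closedBall x r, DifferentiableAt ℂ f z)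
    (hC : ∀ z ∈ Metric.closedBall x r, ‖f z‖ ≤ C) : ‖fderiv ℂ f x‖ ≤ C / r := by
  have hC0 : 0 ≤ C := (norm_nonneg _).trans (hC x (Metric.mem_closedBall_self hr.le))
  refine ContinuousLinearMap.opNorm_le_bound _ (by positivity) fun v => ?_
  rcases eq_or_ne v 0 with rfl | hv
  · simp
  have hv' : 0 < ‖v‖ := norm_pos_iff.2 hv
  have hmem : ∀ t ∈ Metric.closedBall (0 : ℂ) (r / ‖v‖), x + t • v ∈ Metric.closedBall x r := by
    intro t ht
    rw [mem_closedBall_zero_iff, le_div_iff₀ hv'] at ht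
    simpa [norm_smul] using ht
  have hdt : ∀ t ∈ Metric.closedBall (0 : ℂ) (r / ‖v‖), DifferentiableAt ℂ (fun t : ℂ => f (x + t • v)) t :=
    fun t ht => DifferentiableAt.comp t (hd _ (hmem t ht)) (by fun_prop)
  have h := norm_deriv_le_of_forall_mem_sphere_norm_le (c := (0 : ℂ)) (R := r / ‖v‖) (C := C)
    (f := fun t : ℂ => f (x + t • v)) (by positivity)
    (DifferentiableOn.diffContOnCl fun t ht => (hdt t (Metric.closure_ball_subset_closedBall ht)).differentiableWithinAt)
    (fun t ht => hC _ (hmem t (Metric.sphere_subset_closedBall ht)))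
  have hder : HasDerivAt (fun t : ℂ => f (x + t • v)) (fderiv ℂ f x v) 0 := by
    have h1 : HasFDerivAt f (fderiv ℂ f x) (x + (0 : ℂ) • v) := by
      simpa using (hd x (Metric.mem_closedBall_self hr.le)).hasFDerivAt
    have h2 : HasDerivAt (fun t : ℂ => x + t • v) v 0 := by
      simpa using ((hasDerivAt_id (0 : ℂ)).smul_const v).const_add x
    exact h1.comp_hasDerivAt (0 : ℂ) h2
  rw [hder.deriv] at h
  calc _ ≤ C / (r / ‖v‖) := h
    _ = C / r * ‖v‖ := by field_simp

/-- A locally dominated integral of holomorphic functions is holomorphic and can be differentiated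
under the integral sign. -/
theorem hasFDerivAt_integral_of_dominated_holomorphic {m : ℕ} {α : Type*} [MeasurableSpace α]
    {μ : Measure α} {F : (Fin m → ℂ) → α → ℂ} {x₀ : Fin m → ℂ} {B : α → ℝ} (hB : Integrable B μ)
    (hF : ∀ᶠ x in 𝓝 x₀, ∀ s, ‖F x s‖ ≤ B s)
    (hd : ∀ᶠ x in 𝓝 x₀, ∀ s, DifferentiableAt ℂ (fun x => F x s) x)
    (hm : ∀ x, AEStronglyMeasurable (F x) μ) :
    Integrable (fun s => fderiv ℂ (fun x => F x s) x₀) μ ∧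
      HasFDerivAt (fun x => ∫ s, F x s ∂μ) (∫ s, fderiv ℂ (fun x => F x s) x₀ ∂μ) x₀ := by
  obtain ⟨r, hr, hball⟩ := Metric.eventually_nhds_iff_ball.1 (hF.and hd)
  have hsub : ∀ x ∈ Metric.ball x₀ (r / 2), ∀ z ∈ Metric.closedBall x (r / 4), z ∈ Metric.ball x₀ r := by
    intro x hx z hz
    rw [Metric.mem_ball] at hx ⊢
    rw [Metric.mem_closedBall] at hz
    linarith [dist_triangle z x x₀]
  have hx₀ : x₀ ∈ Metric.ball x₀ (r / 2) := Metric.mem_ball_self (by positivity)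
  have hbound : ∀ x ∈ Metric.ball x₀ (r / 2), ∀ s, ‖fderiv ℂ (fun x => F x s) x‖ ≤ B s / (r / 4) :=
    fun x hx s => norm_fderiv_le_of_forall_ball (by positivity)
      (fun z hz => (hball z (hsub x hx z hz)).2 s) (fun z hz => (hball z (hsub x hx z hz)).1 s)
  have hdiff : ∀ x ∈ Metric.ball x₀ (r / 2), ∀ s, HasFDerivAt (fun x => F x s) (fderiv ℂ (fun x => F x s) x) x :=
    fun x hx s => ((hball x (hsub x hx x (Metric.mem_closedBall_self (by positivity)))).2 s).hasFDerivAt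
  -- The derivative in a coordinate direction is a pointwise limit of measurable difference
  -- quotients.
  have hmeas1 : ∀ i : Fin m,
      AEStronglyMeasurable (fun s => fderiv ℂ (fun x => F x s) x₀ (Pi.single i 1)) μ := by
    intro i
    refine aestronglyMeasurable_of_tendsto_ae atTop
      (f := fun (k : ℕ) s => ((k : ℂ)) • (F (x₀ + ((k : ℂ))⁻¹ • Pi.single i 1) s - F x₀ s))
      (fun k => ((hm (x₀ + ((k : ℂ))⁻¹ • Pi.single i 1)).sub (hm x₀)).const_smul (k : ℂ)) (ae_of_all _ fun s => ?_)
    have hc : Tendsto (fun k : ℕ => ‖(k : ℂ)‖) atTop atTop := by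
      simpa using tendsto_natCast_atTop_atTop (R := ℝ)
    simpa using (hdiff x₀ hx₀ s).lim (Pi.single i 1) hc
  have hmeas : AEStronglyMeasurable (fun s => fderiv ℂ (fun x => F x s) x₀) μ := by
    have h1 : (fun s => fderiv ℂ (fun x => F x s) x₀) = fun s => ∑ i, fderiv ℂ (fun x => F x s) x₀ (Pi.single i 1) •
        ContinuousLinearMap.proj (R := ℂ) (φ := fun _ : Fin m => ℂ) i := by
      funext s
      ext v
      conv_lhs => rw [pi_eq_sum_univ' v, map_sum]
      simp [mul_comm]
    rw [h1]
    refine Finset.aestronglyMeasurable_fun_sum _ fun i _ => ?_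
    exact (hmeas1 i).smul_const _
  have hFint : Integrable (F x₀) μ :=
    hB.mono' (hm x₀) (ae_of_all _ (hball x₀ (Metric.mem_ball_self hr)).1)
  refine ⟨(hB.div_const (r / 4)).mono' hmeas (ae_of_all _ (hbound x₀ hx₀)), ?_⟩
  exact hasFDerivAt_integral_of_dominated_of_fderiv_le (bound := fun s => B s / (r / 4))
    (Metric.ball_mem_nhds x₀ (by positivity)) (Eventually.of_forall hm) hFint hmeas
    (ae_of_all _ fun s x hx => hbound x hx s) (hB.div_const _) (ae_of_all _ fun s x hx => hdiff x hx s)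

/-! ### Domination of the integrand and rotation of the rays -/

theorem isOpen_lift (n : ℕ) : IsOpen (lift n) := by
  simp only [lift, Set.ofPred_forall, Set.ofPred_and]
  refine isOpen_iInter_of_finite fun i => IsOpen.inter ?_ ?_
  · exact isOpen_lt continuous_const (by fun_prop)
  · exact isOpen_lt (by fun_prop) continuous_const

theorem exp_ne_exp_of_im_sub {p q : ℂ} (h1 : 0 < (p - q).im) (h2 : (p - q).im < 2 * Real.pi) :
    exp p ≠ exp q := by
  intro h
  obtain ⟨k, hk⟩ := exp_eq_exp_iff_exists_int.1 h
  have h3 : (p - q).im = k * (2 * Real.pi) := by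
    rw [hk]
    simp
  rw [h3] at h1 h2
  have hpi : 0 < 2 * Real.pi := by positivity
  have hk0 : 0 < (k : ℝ) := pos_of_mul_pos_left h1 hpi.le
  have hk1 : (k : ℝ) < 1 := by nlinarith
  have hk0' : 0 < k := by exact_mod_cast hk0
  have hk1' : k < 1 := by exact_mod_cast hk1
  omega

theorem im_gap {n : ℕ} (a : Fin n → ℂ) (y : Fin n → ℝ) (i : Fin (n - 1)) :
    ((y (lo i) - a (lo i)) - (y (hi i) - a (hi i)) : ℂ).im = (a (hi i) - a (lo i)).im := by
  simp only [sub_im, ofReal_im]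
  ring

theorem gap_ne_zero {n : ℕ} {a : Fin n → ℂ} (ha : a ∈ lift n) (y : Fin n → ℝ) (i : Fin (n - 1)) :
    exp (y (lo i) - a (lo i)) - exp (y (hi i) - a (hi i)) ≠ 0 :=
  sub_ne_zero.2 <| exp_ne_exp_of_im_sub (by rw [im_gap]; exact (ha i).1) (by rw [im_gap]; exact (ha i).2)

theorem measurable_core (n : ℕ) (a w : Fin n → ℂ) : Measurable (core n a w) := by
  unfold core
  fun_prop

/-- The directions `a` keep the rays apart and make the exponentials decay. -/
def Admissible (n : ℕ) (a w : Fin n → ℂ) : Prop := a ∈ lift n ∧ ∀ j, 0 < (w j * exp (-a j)).re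

/-- The conditions of `norm_core_le` are strict inequalities at `(a, w)`, so one pair of constants
`κ`, `η` serves a whole neighbourhood. -/
theorem exists_dominating {n : ℕ} (hn : 1 ≤ n) {a w : Fin n → ℂ} (h : Admissible n a w) :
    ∃ B : (Fin n → ℝ) → ℝ, Integrable B ∧
      ∀ᶠ p : (Fin n → ℂ) × (Fin n → ℂ) in 𝓝 (a, w), ∀ y, ‖core n p.1 p.2 y‖ ≤ B y := by
  have hpi := Real.pi_pos
  have e1 : ∀ᶠ κ in 𝓝[>] (0 : ℝ), κ < Real.pi / 2 ∧
      ∀ i : Fin (n - 1), κ < (a (hi i) - a (lo i)).im ∧ (a (hi i) - a (lo i)).im < 2 * Real.pi - κ := by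
    refine nhdsWithin_le_nhds (Filter.Eventually.and (eventually_lt_nhds (by positivity))
      (eventually_all.2 fun i => (eventually_lt_nhds (h.1 i).1).and ?_))
    filter_upwards [eventually_lt_nhds (sub_pos.2 (h.1 i).2)] with κ hκ
    linarith
  obtain ⟨κ, ⟨hκ2, hκ3⟩, hκ1⟩ := (e1.and self_mem_nhdsWithin).exists
  have e2 : ∀ᶠ η in 𝓝[>] (0 : ℝ), ∀ j, η < (w j * exp (-a j)).re :=
    nhdsWithin_le_nhds (eventually_all.2 fun j => eventually_lt_nhds (h.2 j))
  obtain ⟨η, hη2, hη1⟩ := (e2.and self_mem_nhdsWithin).exists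
  have hs : 0 < Real.sin κ := Real.sin_pos_of_pos_of_lt_pi hκ1 (by linarith)
  -- The shift by `1` leaves room for the real parts of nearby directions.
  refine ⟨_, (integrable_prod_exp hn (fun j => (a j).re - 1) (η := fun _ => η)
    (fun _ => hη1)).const_mul (Real.sin κ ^ (n - 1))⁻¹, ?_⟩
  have e3 : ∀ᶠ p : (Fin n → ℂ) × (Fin n → ℂ) in 𝓝 (a, w), ∀ i : Fin (n - 1),
      κ < (p.1 (hi i) - p.1 (lo i)).im ∧ (p.1 (hi i) - p.1 (lo i)).im < 2 * Real.pi - κ := by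
    refine eventually_all.2 fun i => Filter.Eventually.and ?_ ?_
    · have hc : ContinuousAt (fun p : (Fin n → ℂ) × (Fin n → ℂ) =>
        (p.1 (hi i) - p.1 (lo i)).im) (a, w) := by fun_prop
      exact hc.tendsto.eventually_const_lt (hκ3 i).1
    · have hc : ContinuousAt (fun p : (Fin n → ℂ) × (Fin n → ℂ) =>
        (p.1 (hi i) - p.1 (lo i)).im) (a, w) := by fun_prop
      exact hc.tendsto.eventually_lt_const (hκ3 i).2
  have e4 : ∀ᶠ p : (Fin n → ℂ) × (Fin n → ℂ) in 𝓝 (a, w), ∀ j,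
      η < (p.2 j * exp (-p.1 j)).re ∧ (a j).re - 1 < (p.1 j).re := by
    refine eventually_all.2 fun j => Filter.Eventually.and ?_ ?_
    · have hc : ContinuousAt (fun p : (Fin n → ℂ) × (Fin n → ℂ) =>
        (p.2 j * exp (-p.1 j)).re) (a, w) := by fun_prop
      exact hc.tendsto.eventually_const_lt (hη2 j)
    · have hc : ContinuousAt (fun p : (Fin n → ℂ) × (Fin n → ℂ) =>
        (p.1 j).re) (a, w) := by fun_prop
      exact hc.tendsto.eventually_const_lt (sub_one_lt _)
  filter_upwards [e3, e4] with p h3 h4 y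
  refine (norm_core_le hn hκ1 hκ2.le (fun i => ⟨(h3 i).1.le, (h3 i).2.le⟩)
    (η := fun _ => η) (fun j => (h4 j).1.le) y).trans ?_
  refine mul_le_mul_of_nonneg_left ?_ (by positivity)
  refine Finset.prod_le_prod (fun j _ => by positivity) fun j _ => ?_
  refine mul_le_mul_of_nonneg_right (Real.exp_le_exp.2 ?_) (by positivity)
  have := (h4 j).2
  gcongr

theorem integrable_core {n : ℕ} (hn : 1 ≤ n) {a w : Fin n → ℂ} (h : Admissible n a w) :
    Integrable (core n a w) := by
  obtain ⟨B, hB, hb⟩ := exists_dominating hn h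
  exact hB.mono' (measurable_core n a w).aestronglyMeasurable (ae_of_all _ hb.self_of_nhds)

theorem coreIntegral_translate {n : ℕ} (a w : Fin n → ℂ) (v : Fin n → ℝ) :
    coreIntegral n (fun j => a j + v j) w = coreIntegral n a w := by
  rw [coreIntegral, coreIntegral, ← integral_sub_right_eq_self (core n a w) v]
  congr 1 with y
  have e : ∀ j, (y j - (a j + v j) : ℂ) = y j - v j - a j := fun j => by ring
  simp only [core, Pi.sub_apply, ofReal_sub, e]

theorem differentiableAt_finset_prod {E ι : Type*} [NormedAddCommGroup E] [NormedSpace ℂ E]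
    {s : Finset ι} {f : ι → E → ℂ} {x : E} (h : ∀ i ∈ s, DifferentiableAt ℂ (f i) x) :
    DifferentiableAt ℂ (fun x => ∏ i ∈ s, f i x) x := by
  classical
  induction s using Finset.induction_on with
  | empty => simp
  | insert i s hi ih =>
    simp only [Finset.prod_insert hi]
    exact (h i (Finset.mem_insert_self i s)).mul
      (ih fun j hj => h j (Finset.mem_insert_of_mem hj))

/-- The integral is holomorphic in `a`, and a real shift of `a` is absorbed by translating `y`. The
derivative thus vanishes on real vectors and, being complex linear, everywhere. -/
theorem hasFDerivAt_coreIntegral_left {n : ℕ} (hn : 1 ≤ n) {a w : Fin n → ℂ} (h : Admissible n a w) :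
    HasFDerivAt (fun a => coreIntegral n a w) (0 : (Fin n → ℂ) →L[ℂ] ℂ) a := by
  obtain ⟨B, hB, hb⟩ := exists_dominating hn h
  have hb' : ∀ᶠ a' in 𝓝 a, ∀ y, ‖core n a' w y‖ ≤ B y :=
    (ContinuousAt.prodMk continuousAt_id continuousAt_const).eventually hb
  have hd : ∀ᶠ a' in 𝓝 a, ∀ y, DifferentiableAt ℂ (fun a => core n a w y) a' := by
    filter_upwards [(isOpen_lift n).mem_nhds h.1] with a' ha' y
    unfold core
    have h1 : DifferentiableAt ℂ (fun a : Fin n → ℂ => ∏ i : Fin (n - 1),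
        (exp (y (lo i) - a (lo i)) - exp (y (hi i) - a (hi i)))⁻¹) a' := by
      refine differentiableAt_finset_prod fun i _ => ?_
      exact DifferentiableAt.fun_inv (by fun_prop) (gap_ne_zero ha' y i)
    refine DifferentiableAt.mul (DifferentiableAt.mul ?_ (by fun_prop)) h1
    exact differentiableAt_finset_prod fun i _ => by fun_prop
  obtain ⟨-, hder⟩ := hasFDerivAt_integral_of_dominated_holomorphic hB hb' hd
    (fun a => (measurable_core n a w).aestronglyMeasurable)
  set L := ∫ y, fderiv ℂ (fun a => core n a w y) a with hL
  have hL0 : L = 0 := by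
    refine ContinuousLinearMap.ext_on (s := Set.range fun j : Fin n => Pi.single j (1 : ℂ)) ?_ ?_
    · have := (Pi.basisFun ℂ (Fin n)).span_eq
      simp only [Pi.basisFun_apply, Set.range] at this ⊢
      rw [this]
      exact dense_univ
    rintro _ ⟨j, rfl⟩
    have h1 : HasDerivAt (fun t : ℝ => a + t • (Pi.single j (1 : ℂ) : Fin n → ℂ)) (Pi.single j 1) 0 := by
      simpa using ((hasDerivAt_id (0 : ℝ)).smul_const (Pi.single j (1 : ℂ) : Fin n → ℂ)).const_add a
    have h2 : HasDerivAt (fun t : ℝ => coreIntegral n (a + t • (Pi.single j (1 : ℂ) : Fin n → ℂ)) w)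
        (L (Pi.single j 1)) 0 := by
      have h0 : HasFDerivAt (fun a => coreIntegral n a w) (L.restrictScalars ℝ)
          (a + (0 : ℝ) • (Pi.single j (1 : ℂ) : Fin n → ℂ)) := by
        rw [zero_smul, add_zero]
        exact hder.restrictScalars ℝ
      exact h0.comp_hasDerivAt (0 : ℝ) h1
    have h3 : (fun t : ℝ => coreIntegral n (a + t • (Pi.single j (1 : ℂ) : Fin n → ℂ)) w) =
        fun _ => coreIntegral n a w := by
      funext t
      rw [← coreIntegral_translate a w (t • Pi.single j 1)]
      congr 1
      funext k
      by_cases hk : k = j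
      · subst hk; simp
      · simp [hk]
    rw [h3] at h2
    simpa using h2.unique (hasDerivAt_const (0 : ℝ) _)
  rw [← hL0]
  exact hder

/-- The directions adapted to the weights `exp b`. -/
def sector (n : ℕ) (b : Fin n → ℂ) : Set (Fin n → ℂ) :=
  {a | a ∈ lift n ∧ ∀ j, -(Real.pi / 2) < (b j - a j).im ∧ (b j - a j).im < Real.pi / 2}

theorem re_exp_mul_exp_neg (b a : ℂ) :
    (exp b * exp (-a)).re = Real.exp (b.re - a.re) * Real.cos (b - a).im := by
  rw [← exp_add, ← sub_eq_add_neg, exp_re, sub_re]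

theorem admissible_of_mem_sector {n : ℕ} {a b : Fin n → ℂ} (h : a ∈ sector n b) :
    Admissible n a (fun j => exp (b j)) := by
  refine ⟨h.1, fun j => ?_⟩
  rw [re_exp_mul_exp_neg]
  exact mul_pos (Real.exp_pos _) (Real.cos_pos_of_mem_Ioo (h.2 j))

theorem mem_sector_self {n : ℕ} {a : Fin n → ℂ} (h : a ∈ lift n) : a ∈ sector n a :=
  ⟨h, fun j => by simp [Real.pi_pos]⟩

theorem convex_lift (n : ℕ) : Convex ℝ (lift n) := by
  intro a ha a' ha' s t hs ht hst i
  have := (convex_Ioo 0 (2 * Real.pi)) (ha i) (ha' i) hs ht hst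
  have e : ((s • a + t • a') (hi i) - (s • a + t • a') (lo i)).im =
      s • (a (hi i) - a (lo i)).im + t • (a' (hi i) - a' (lo i)).im := by
    simp
    ring
  rw [e]
  exact this

theorem convex_sector (n : ℕ) (b : Fin n → ℂ) : Convex ℝ (sector n b) := by
  intro a ha a' ha' s t hs ht hst
  refine ⟨convex_lift n ha.1 ha'.1 hs ht hst, fun j => ?_⟩
  have := (convex_Ioo (-(Real.pi / 2)) (Real.pi / 2)) (ha.2 j) (ha'.2 j) hs ht hst
  have e : (b j - (s • a + t • a') j).im = s • (b j - a j).im + t • (b j - a' j).im := by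
    obtain rfl : t = 1 - s := by linarith
    simp
    ring
  rw [e]
  exact this

/-- The rays can be rotated as long as they stay apart and the exponentials decay. -/
theorem coreIntegral_eq_of_mem_sector {n : ℕ} (hn : 1 ≤ n) {b a a' : Fin n → ℂ}
    (ha : a ∈ sector n b) (ha' : a' ∈ sector n b) :
    coreIntegral n a (fun j => exp (b j)) = coreIntegral n a' (fun j => exp (b j)) := by
  have hder := fun x (hx : x ∈ sector n b) =>
    ((hasFDerivAt_coreIntegral_left hn (admissible_of_mem_sector hx)).hasFDerivWithinAt
      (s := sector n b))
  have := (convex_sector n b).norm_image_sub_le_of_norm_hasFDerivWithin_le (C := 0) hder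
    (fun x _ => by simp) ha' ha
  simpa [sub_eq_zero] using this

/-! ### Factorization at a gap and the derivative in the weights -/

theorem prod_fin_split {M : Type*} [CommMonoid M] {n p q : ℕ} (h : p + q = n) (f : Fin n → M) :
    ∏ j, f j = (∏ j : Fin p, f ⟨j, by omega⟩) * ∏ j : Fin q, f ⟨p + j, by omega⟩ := by
  subst h
  rw [Fin.prod_univ_add]
  rfl

theorem sum_fin_split {M : Type*} [AddCommMonoid M] {n p q : ℕ} (h : p + q = n) (f : Fin n → M) :
    ∑ j, f j = (∑ j : Fin p, f ⟨j, by omega⟩) + ∑ j : Fin q, f ⟨p + j, by omega⟩ := by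
  subst h
  rw [Fin.sum_univ_add]
  rfl

theorem integral_fin_split {n p q : ℕ} (h : p + q = n) (f : (Fin p → ℝ) → ℂ)
    (g : (Fin q → ℝ) → ℂ) :
    ∫ y : Fin n → ℝ, f (fun j => y ⟨j, by omega⟩) * g (fun j => y ⟨p + j, by omega⟩) =
      (∫ y, f y) * ∫ y, g y := by
  subst h
  have h1 := volume_measurePreserving_piCongrLeft (fun _ : Fin (p + q) => ℝ) (finSumFinEquiv (m := p) (n := q))
  have h2 := volume_measurePreserving_sumPiEquivProdPi_symm (fun _ : Fin p ⊕ Fin q => ℝ)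
  have h3 := h1.comp h2
  rw [← integral_prod_mul, ← Measure.volume_eq_prod]
  have h4 := h3.integral_comp ((MeasurableEquiv.measurableEmbedding _).comp (MeasurableEquiv.measurableEmbedding _))
    (fun y : Fin (p + q) → ℝ => f (fun j => y ⟨j, by omega⟩) * g (fun j => y ⟨p + j, by omega⟩))
  rw [← h4]
  refine integral_congr_ae (ae_of_all _ fun y => ?_)
  simp only [Function.comp]
  congr 2
  · funext j
    exact Equiv.piCongrLeft_apply_apply (fun _ : Fin (p + q) => ℝ) finSumFinEquiv _ (Sum.inl j)
  · funext j
    exact Equiv.piCongrLeft_apply_apply (fun _ : Fin (p + q) => ℝ) finSumFinEquiv _ (Sum.inr j)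

/-- The inverse of the `k`-th gap is the only factor that couples the first `k + 1` variables to the
others. -/
theorem core_mul_gap {n : ℕ} {a : Fin n → ℂ} (ha : a ∈ lift n) (w : Fin n → ℂ) (y : Fin n → ℝ)
    (k : Fin (n - 1)) :
    (exp (y (lo k) - a (lo k)) - exp (y (hi k) - a (hi k))) * core n a w y =
      core (k + 1) (head k a) (head k w) (fun j => y ⟨j, by omega⟩) *
        core (n - (k + 1)) (tail k a) (tail k w) (fun j => y ⟨k + 1 + j, by omega⟩) := by
  have hk := k.2
  have hgap := gap_ne_zero ha y k
  rw [core, prod_fin_split (p := k + 1) (q := n - (k + 1)) (by omega) (fun j => exp (y j - a j)),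
    sum_fin_split (p := k + 1) (q := n - (k + 1)) (by omega) (fun j => w j * exp (y j - a j)),
    prod_fin_split (p := k) (q := n - 1 - k) (by omega)
      (fun i : Fin (n - 1) => (exp (y (lo i) - a (lo i)) - exp (y (hi i) - a (hi i)))⁻¹),
    -- The `n - 1` gaps split into `k` gaps of the head, the gap to be cancelled, and `n - k - 2`
    -- gaps of the tail.
    prod_fin_split (p := 1) (q := n - (k + 1) - 1) (n := n - 1 - k) (by omega), mul_add, exp_add]
  simp only [core, head, tail, Fin.prod_univ_one]
  have e1 : ∀ i : Fin (n - (k + 1) - 1),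
      (exp (y ⟨k + (1 + i), by omega⟩ - a ⟨k + (1 + i), by omega⟩) -
        exp (y ⟨k + (1 + i) + 1, by omega⟩ - a ⟨k + (1 + i) + 1, by omega⟩))⁻¹ =
      (exp (y ⟨k + 1 + i, by omega⟩ - a ⟨k + 1 + i, by omega⟩) -
        exp (y ⟨k + 1 + (i + 1), by omega⟩ - a ⟨k + 1 + (i + 1), by omega⟩))⁻¹ := by
    intro i
    have q1 : (⟨k + (1 + i), by omega⟩ : Fin n) = ⟨k + 1 + i, by omega⟩ :=
      Fin.ext (add_assoc (k : ℕ) 1 i).symm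
    have q2 : (⟨k + (1 + i) + 1, by omega⟩ : Fin n) = ⟨k + 1 + (i + 1), by omega⟩ :=
      Fin.ext (show (k : ℕ) + (1 + i) + 1 = k + 1 + (i + 1) by omega)
    rw [q1, q2]
  simp only [e1]
  have e2 : (⟨(k : ℕ) + 0, by omega⟩ : Fin n) = lo k := rfl
  simp only [Fin.val_zero, e2]
  have key : ∀ A B E₁ E₂ F H g : ℂ, g ≠ 0 →
      g * (A * B * (E₁ * E₂) * (F * (g⁻¹ * H))) = A * E₁ * F * (B * E₂ * H) := by
    intros
    field_simp
  exact key _ _ _ _ _ _ _ hgap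

theorem head_mem_lift {n : ℕ} {a : Fin n → ℂ} (ha : a ∈ lift n) (k : Fin (n - 1)) :
    head k a ∈ lift (k + 1) := fun i => ha ⟨i, by omega⟩

theorem tail_mem_lift {n : ℕ} {a : Fin n → ℂ} (ha : a ∈ lift n) (k : Fin (n - 1)) :
    tail k a ∈ lift (n - (k + 1)) := fun i => ha ⟨k + 1 + i, by omega⟩

theorem integral_gap_mul_core {n : ℕ} {a : Fin n → ℂ} (ha : a ∈ lift n) (w : Fin n → ℂ)
    (k : Fin (n - 1)) :
    ∫ y : Fin n → ℝ, (exp (y (lo k) - a (lo k)) - exp (y (hi k) - a (hi k))) * core n a w y =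
      coreIntegral (k + 1) (head k a) (head k w) *
        coreIntegral (n - (k + 1)) (tail k a) (tail k w) := by
  simp only [core_mul_gap ha]
  exact integral_fin_split (by omega) _ _

theorem hasFDerivAt_core (n : ℕ) (a w : Fin n → ℂ) (y : Fin n → ℝ) :
    HasFDerivAt (fun w => core n a w y) (core n a w y • (-(2 * Real.pi : ℂ)) •
      ∑ j, exp (y j - a j) • ContinuousLinearMap.proj (R := ℂ) (φ := fun _ : Fin n => ℂ) j) w := by
  have h1 : HasFDerivAt (fun w : Fin n → ℂ => -(2 * Real.pi : ℂ) * ∑ j, w j * exp (y j - a j))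
      ((-(2 * Real.pi : ℂ)) •
        ∑ j, exp (y j - a j) • ContinuousLinearMap.proj (R := ℂ) (φ := fun _ : Fin n => ℂ) j) w := by
    refine HasFDerivAt.const_mul ?_ _
    exact HasFDerivAt.fun_sum fun j _ => (ContinuousLinearMap.hasFDerivAt
      (ContinuousLinearMap.proj (R := ℂ) (φ := fun _ : Fin n => ℂ) j)).mul_const _
  have h2 := (h1.cexp.const_mul (∏ j, exp (y j - a j))).mul_const
    (∏ i : Fin (n - 1), (exp (y (lo i) - a (lo i)) - exp (y (hi i) - a (hi i)))⁻¹)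
  refine h2.congr_fderiv ?_
  ext v
  simp only [core, _root_.smul_apply, smul_eq_mul]
  ring

/-- The `n` numerators against `n - 1` gaps leave one factor `exp (-c)`. Together with the
invariance under real shifts this makes the integral homogeneous of degree `-1` in the weights. -/
theorem core_scale {n : ℕ} (hn : 1 ≤ n) (a w : Fin n → ℂ) (y : Fin n → ℝ) (c : ℂ) :
    core n (fun j => a j + c) (fun j => exp c * w j) y = exp (-c) * core n a w y := by
  have e : ∀ j, exp (y j - (a j + c)) = exp (-c) * exp (y j - a j) := by
    intro j
    rw [← exp_add]
    ring_nf
  have e2 : ∀ j, exp c * w j * (exp (-c) * exp (y j - a j)) = w j * exp (y j - a j) := by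
    intro j
    rw [exp_neg]
    field_simp
  have hcard : exp (-c) ^ n = exp (-c) * exp (-c) ^ (n - 1) := by
    rw [← pow_succ', Nat.sub_add_cancel hn]
  simp only [core, e, e2, ← mul_sub, mul_inv, Finset.prod_mul_distrib, Finset.prod_const,
    Finset.card_univ, Fintype.card_fin]
  rw [hcard, inv_pow]
  have key : ∀ x N P E Q : ℂ, N ≠ 0 → x * N * P * E * (N⁻¹ * Q) = x * (P * E * Q) := by
    intros
    field_simp
  exact key _ _ _ _ _ (pow_ne_zero _ (exp_ne_zero _))

theorem coreIntegral_scale {n : ℕ} (hn : 1 ≤ n) (a w : Fin n → ℂ) (t : ℝ) :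
    coreIntegral n a (fun j => exp t * w j) = exp (-t) * coreIntegral n a w := by
  rw [← coreIntegral_translate a _ (fun _ => t)]
  simp only [coreIntegral, core_scale hn, integral_const_mul]

/-- Differentiation in `w_j` inserts `-2π x_j`. The value on `w` is Euler's relation for degree
`-1`; in the difference over a gap the inserted factor cancels a pole and the integral factorizes.
-/
theorem hasFDerivAt_coreIntegral_right {n : ℕ} (hn : 1 ≤ n) {a w : Fin n → ℂ}
    (h : Admissible n a w) :
    ∃ L : (Fin n → ℂ) →L[ℂ] ℂ, HasFDerivAt (coreIntegral n a) L w ∧ L w = -coreIntegral n a w ∧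
      ∀ k : Fin (n - 1), L (Pi.single (lo k) 1) - L (Pi.single (hi k) 1) =
        -(2 * Real.pi) * (coreIntegral (k + 1) (head k a) (head k w) *
          coreIntegral (n - (k + 1)) (tail k a) (tail k w)) := by
  obtain ⟨B, hB, hb⟩ := exists_dominating hn h
  have hb' : ∀ᶠ w' in 𝓝 w, ∀ y, ‖core n a w' y‖ ≤ B y :=
    (ContinuousAt.prodMk continuousAt_const continuousAt_id).eventually hb
  obtain ⟨hint, hder⟩ := hasFDerivAt_integral_of_dominated_holomorphic hB hb'
    (Eventually.of_forall fun w' y => (hasFDerivAt_core n a w' y).differentiableAt)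
    (fun w' => (measurable_core n a w').aestronglyMeasurable)
  have hsingle : ∀ (j : Fin n) (y : Fin n → ℝ), fderiv ℂ (fun w => core n a w y) w (Pi.single j 1) =
      -(2 * Real.pi) * (exp (y j - a j) * core n a w y) := by
    intro j y
    rw [(hasFDerivAt_core n a w y).fderiv]
    simp [Pi.single_apply]
    ring
  refine ⟨_, hder, ?_, fun k => ?_⟩
  · set L := ∫ y, fderiv ℂ (fun w => core n a w y) w
    have h1 : HasDerivAt (fun t : ℝ => fun j => exp t * w j) w 0 := by
      refine hasDerivAt_pi.2 fun j => ?_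
      have := ((hasDerivAt_exp (0 : ℝ)).comp_ofReal.mul_const (w j))
      simpa using this
    have h2 : HasDerivAt (fun t : ℝ => coreIntegral n a (fun j => exp t * w j)) (L w) 0 := by
      have h0 : HasFDerivAt (coreIntegral n a) (L.restrictScalars ℝ) (fun j => exp (0 : ℝ) * w j) := by
        have e : (fun j => exp (0 : ℝ) * w j) = w := by simp
        rw [e]
        exact hder.restrictScalars ℝ
      exact h0.comp_hasDerivAt (0 : ℝ) h1
    simp only [coreIntegral_scale hn] at h2
    have h3 : HasDerivAt (fun t : ℝ => exp (-t) * coreIntegral n a w) (-coreIntegral n a w) 0 := by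
      have := (((hasDerivAt_id (0 : ℂ)).fun_neg.cexp).comp_ofReal (z := 0)).mul_const (coreIntegral n a w)
      simpa using this
    exact h2.unique h3
  · rw [ContinuousLinearMap.integral_apply hint, ContinuousLinearMap.integral_apply hint,
      ← integral_sub (hint.apply_continuousLinearMap _) (hint.apply_continuousLinearMap _),
      ← integral_gap_mul_core h.1, ← integral_const_mul]
    refine integral_congr_ae (ae_of_all _ fun y => ?_)
    simp only [hsingle]
    ring

theorem eq_smul_sum_proj {n : ℕ} (hn : 1 ≤ n) {L : (Fin n → ℂ) →L[ℂ] ℂ}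
    (h : ∀ k : Fin (n - 1), L (Pi.single (lo k) 1) = L (Pi.single (hi k) 1)) :
    ∃ d : ℂ, ∀ v, L v = d * ∑ j, v j := by
  have hc : ∀ (m : ℕ) (hm : m < n), L (Pi.single ⟨m, hm⟩ 1) = L (Pi.single ⟨0, hn⟩ 1) := by
    intro m
    induction m with
    | zero => intro _; rfl
    | succ m ih => intro hm; rw [← ih (by omega)]; exact (h ⟨m, by omega⟩).symm
  refine ⟨L (Pi.single ⟨0, hn⟩ 1), fun v => ?_⟩
  conv_lhs => rw [pi_eq_sum_univ' v, map_sum]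
  rw [Finset.mul_sum]
  refine Finset.sum_congr rfl fun j _ => ?_
  rw [map_smul, smul_eq_mul, hc j j.2, mul_comm]

/-! ### The ray integral in logarithmic coordinates -/

theorem orthant_eq_image {n : ℕ} {c : ℝ} (hc : c ≠ 0) :
    orthant n = (fun (y : Fin n → ℝ) j => Real.exp (c * y j)) '' Set.univ := by
  ext r
  simp only [orthant, Set.image_univ, Set.mem_range]
  constructor
  · intro hr
    refine ⟨fun j => Real.log (r j) / c, ?_⟩
    funext j
    rw [mul_div_cancel₀ _ hc, Real.exp_log (hr j)]
  · rintro ⟨y, rfl⟩ j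
    exact Real.exp_pos _

theorem hasFDerivAt_exp_pi {n : ℕ} (c : ℝ) (y : Fin n → ℝ) :
    HasFDerivAt (fun (y : Fin n → ℝ) j => Real.exp (c * y j))
      (ContinuousLinearMap.pi fun j => ((c * Real.exp (c * y j)) •
        ContinuousLinearMap.id ℝ ℝ) ∘L ContinuousLinearMap.proj j) y := by
  refine hasFDerivAt_pi.2 fun j => ?_
  have h := (((hasDerivAt_id (y j)).const_mul c).exp).comp_hasFDerivAt y
    (ContinuousLinearMap.hasFDerivAt (ContinuousLinearMap.proj (R := ℝ) (φ := fun _ : Fin n => ℝ) j))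
  refine h.congr_fderiv ?_
  ext v
  simp [mul_comm]

theorem abs_det_exp_pi {n : ℕ} {c : ℝ} (hc : |c| = 1) (y : Fin n → ℝ) :
    |(ContinuousLinearMap.pi fun j => ((c * Real.exp (c * y j)) •
        ContinuousLinearMap.id ℝ ℝ) ∘L ContinuousLinearMap.proj (R := ℝ) (φ := fun _ : Fin n => ℝ) j).det| =
      ∏ j, Real.exp (c * y j) := by
  rw [ContinuousLinearMap.det_pi]
  simp [ContinuousLinearMap.det, Finset.abs_prod, abs_mul, hc]

theorem injective_exp_pi {n : ℕ} {c : ℝ} (hc : c ≠ 0) :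
    Function.Injective (fun (y : Fin n → ℝ) j => Real.exp (c * y j)) := by
  intro y y' h
  funext j
  exact mul_left_cancel₀ hc (Real.exp_injective (congrFun h j))

/-- The sign `c = -1` serves the ray parameters, which are inverse to `x`; `c = 1` serves the
simplex integral. -/
theorem integrableOn_orthant_iff {n : ℕ} {c : ℝ} (hc : |c| = 1) (f : (Fin n → ℝ) → ℂ) :
    IntegrableOn f (orthant n) ↔
      Integrable fun y : Fin n → ℝ => (∏ j, exp (c * y j)) * f fun j => Real.exp (c * y j) := by
  have hc0 : c ≠ 0 := by rintro rfl; simp at hc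
  rw [orthant_eq_image hc0, integrableOn_image_iff_integrableOn_abs_det_fderiv_smul volume
    MeasurableSet.univ (fun y _ => (hasFDerivAt_exp_pi c y).hasFDerivWithinAt)
    (injective_exp_pi hc0).injOn, integrableOn_univ]
  simp only [abs_det_exp_pi hc, real_smul, ofReal_prod, ofReal_exp, ofReal_mul]

theorem integral_orthant {n : ℕ} {c : ℝ} (hc : |c| = 1) (f : (Fin n → ℝ) → ℂ) :
    ∫ r in orthant n, f r =
      ∫ y : Fin n → ℝ, (∏ j, exp (c * y j)) * f fun j => Real.exp (c * y j) := by
  have hc0 : c ≠ 0 := by rintro rfl; simp at hc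
  rw [orthant_eq_image hc0, integral_image_eq_integral_abs_det_fderiv_smul volume
    MeasurableSet.univ (fun y _ => (hasFDerivAt_exp_pi c y).hasFDerivWithinAt)
    (injective_exp_pi hc0).injOn, setIntegral_univ]
  simp only [abs_det_exp_pi hc, real_smul, ofReal_prod, ofReal_exp, ofReal_mul]

/-- Here `t_j = i / x_j`: every variable contributes `i⁻¹` and every gap contributes `i`, so one
`i⁻¹` is left. -/
theorem rayIntegrand_exp {n : ℕ} (hn : 1 ≤ n) (a : Fin n → ℂ) (y : Fin n → ℝ) :
    (∏ j, exp ((-1 : ℝ) * y j)) *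
        rayIntegrand n (fun j => exp (a j)) (fun j => Real.exp ((-1 : ℝ) * y j)) =
      I⁻¹ * core n a (fun j => exp (a j)) y := by
  have hx : ∀ j, exp ((-1 : ℝ) * y j) = (exp (a j) * exp (y j - a j))⁻¹ := by
    intro j
    rw [← exp_add, ← exp_neg]
    congr 1
    push_cast
    ring
  have hI := I_ne_zero
  have e1 : ∀ j, exp ((-1 : ℝ) * y j) * (I * exp (a j)) * (exp (-(2 * Real.pi * I) * exp (a j) /
      (I * exp (a j) * exp ((-1 : ℝ) * y j))) / (I * exp (a j) * exp ((-1 : ℝ) * y j)) ^ 2) =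
      I⁻¹ * (exp (y j - a j) * exp (-(2 * Real.pi) * (exp (a j) * exp (y j - a j)))) := by
    intro j
    rw [hx]
    have h1 := exp_ne_zero (a j)
    have h2 := exp_ne_zero (y j - a j)
    have h3 : -(2 * Real.pi * I) * exp (a j) / (I * exp (a j) * (exp (a j) * exp (y j - a j))⁻¹) =
        -(2 * Real.pi) * (exp (a j) * exp (y j - a j)) := by
      field_simp
    rw [h3]
    field_simp
  have e2 : ∀ x x' z z' : ℂ, x ≠ 0 → x' ≠ 0 → z ≠ 0 → z' ≠ 0 →
      I * z * (z * x)⁻¹ * (I * z' * (z' * x')⁻¹) / (I * z' * (z' * x')⁻¹ - I * z * (z * x)⁻¹) =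
        I * (x - x')⁻¹ := by
    intro x x' z z' h1 h2 h3 h4
    have h5 : I * z' * (z' * x')⁻¹ - I * z * (z * x)⁻¹ = I * (x - x') * (x * x')⁻¹ := by
      field_simp
    rw [h5]
    -- For `x = x'` both sides are `0` by the convention for division by zero.
    rcases eq_or_ne (x - x') 0 with h0 | h0
    · simp [h0]
    · field_simp
  have hIn : (I⁻¹ : ℂ) ^ n * I ^ (n - 1) = I⁻¹ := by
    conv_lhs => rw [show n = (n - 1) + 1 by omega]
    rw [pow_succ, Nat.add_sub_cancel, inv_pow]
    field_simp
  have hA : (∏ j, exp ((-1 : ℝ) * y j)) * ((∏ j, I * exp (a j)) *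
      ∏ j, (exp (-(2 * Real.pi * I) * exp (a j) / (I * exp (a j) * exp ((-1 : ℝ) * y j))) /
        (I * exp (a j) * exp ((-1 : ℝ) * y j)) ^ 2)) = I⁻¹ ^ n * ((∏ j, exp (y j - a j)) *
      exp (-(2 * Real.pi) * ∑ j, exp (a j) * exp (y j - a j))) := by
    rw [Finset.mul_sum, exp_sum, ← Finset.prod_mul_distrib, ← Finset.prod_mul_distrib,
      ← Finset.prod_mul_distrib, ← Fin.prod_const, ← Finset.prod_mul_distrib]
    refine Finset.prod_congr rfl fun j _ => ?_
    rw [← e1]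
    ring
  have hB : (∏ i : Fin (n - 1), I * exp (a (lo i)) * exp ((-1 : ℝ) * y (lo i)) *
      (I * exp (a (hi i)) * exp ((-1 : ℝ) * y (hi i))) /
      (I * exp (a (hi i)) * exp ((-1 : ℝ) * y (hi i)) - I * exp (a (lo i)) * exp ((-1 : ℝ) * y (lo i)))) =
      I ^ (n - 1) * ∏ i : Fin (n - 1), (exp (y (lo i) - a (lo i)) - exp (y (hi i) - a (hi i)))⁻¹ := by
    rw [← Fin.prod_const, ← Finset.prod_mul_distrib]
    refine Finset.prod_congr rfl fun i _ => ?_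
    rw [hx, hx]
    exact e2 _ _ _ _ (exp_ne_zero _) (exp_ne_zero _) (exp_ne_zero _) (exp_ne_zero _)
  simp only [rayIntegrand, kernel, rayPoint, ofReal_exp, ofReal_mul]
  rw [hB, core]
  calc _ = (∏ j, exp ((-1 : ℝ) * y j)) * ((∏ j, I * exp (a j)) *
      ∏ j, (exp (-(2 * Real.pi * I) * exp (a j) / (I * exp (a j) * exp ((-1 : ℝ) * y j))) /
        (I * exp (a j) * exp ((-1 : ℝ) * y j)) ^ 2)) * (I ^ (n - 1) *
        ∏ i : Fin (n - 1), (exp (y (lo i) - a (lo i)) - exp (y (hi i) - a (hi i)))⁻¹) := by ring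
    _ = (I⁻¹ ^ n * I ^ (n - 1)) * ((∏ j, exp (y j - a j)) *
      exp (-(2 * Real.pi) * ∑ j, exp (a j) * exp (y j - a j)) *
        ∏ i : Fin (n - 1), (exp (y (lo i) - a (lo i)) - exp (y (hi i) - a (hi i)))⁻¹) := by
        rw [hA]; ring
    _ = _ := by rw [hIn]

theorem integrableOn_rayIntegrand {n : ℕ} (hn : 1 ≤ n) {a : Fin n → ℂ} (ha : a ∈ lift n) :
    IntegrableOn (rayIntegrand n fun j => exp (a j)) (orthant n) := by
  rw [integrableOn_orthant_iff (c := -1) (by simp)]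
  simp only [rayIntegrand_exp hn]
  exact (integrable_core hn (admissible_of_mem_sector (mem_sector_self ha))).const_mul _

/-- The common prefactor of the integrals. -/
def prefactor (n : ℕ) : ℂ := 2 * Real.pi / (2 * Real.pi * I) ^ n

theorem rayJ_exp {n : ℕ} (hn : 1 ≤ n) (a : Fin n → ℂ) :
    rayJ n (fun j => exp (a j)) =
      prefactor n * (∑ j, exp (a j)) * coreIntegral n a (fun j => exp (a j)) := by
  rw [rayJ, integral_orthant (c := -1) (by simp)]
  simp only [rayIntegrand_exp hn, integral_const_mul, coreIntegral, prefactor]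
  have h : (2 * Real.pi * I : ℂ) ^ n = (2 * Real.pi * I) ^ (n - 1) * (2 * Real.pi * I) := by
    rw [← pow_succ, Nat.sub_add_cancel hn]
  have hpi : (Real.pi : ℂ) ≠ 0 := by exact_mod_cast Real.pi_ne_zero
  have hI := I_ne_zero
  rw [h]
  field_simp

/-! ### The simplex integral -/

/-- In the variables `s_j = exp (y_j)` the exponential depends only on `∑ s_j`, and the remaining
factor is homogeneous; this is what allows the scale to be integrated out. -/
theorem core_exp_eq {n : ℕ} (a : Fin n → ℂ) (y : Fin n → ℝ) :
    core n a (fun j => exp (a j)) y = (∏ j, exp ((1 : ℝ) * y j)) *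
      ((∏ j, exp (a j))⁻¹ * (exp (-(2 * Real.pi) * ∑ j, (Real.exp (1 * y j) : ℂ)) *
        (∏ i : Fin (n - 1), ((Real.exp (1 * y (lo i)) : ℂ) / exp (a (lo i)) -
          (Real.exp (1 * y (hi i)) : ℂ) / exp (a (hi i))))⁻¹)) := by
  simp only [core, one_mul, ofReal_one, ofReal_exp, exp_sub, Finset.prod_div_distrib,
    Finset.prod_inv_distrib]
  rw [div_eq_mul_inv]
  have e2 : ∀ j, exp (a j) * (exp (y j) / exp (a j)) = exp (y j) := fun j => by
    rw [mul_div_cancel₀ _ (exp_ne_zero _)]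
  simp only [e2]
  ring

theorem orthant_ae_eq (n : ℕ) : (orthant n : Set (Fin n → ℝ)) =ᵐ[volume] {s | ∀ j, 0 ≤ s j} := by
  have h := Measure.univ_pi_Ioi_ae_eq_Ici (μ := fun _ : Fin n => (volume : Measure ℝ)) (f := fun _ => 0)
  have e1 : orthant n = Set.univ.pi fun _ => Set.Ioi 0 := by
    ext; simp [orthant]
  have e2 : {s : Fin n → ℝ | ∀ j, 0 ≤ s j} = Set.Ici fun _ => 0 := by
    ext; simp [Pi.le_def]
  rw [e1, e2]
  exact h

/-- A shear: it makes the sum `l` of all coordinates the last variable without a Jacobian. -/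
theorem measurePreserving_snoc_sub_sum (m : ℕ) :
    MeasurePreserving (fun p : (Fin m → ℝ) × ℝ =>
      (Fin.snoc p.1 (p.2 - ∑ j, p.1 j) : Fin (m + 1) → ℝ)) := by
  have h1 : MeasurePreserving (fun p : (Fin m → ℝ) × ℝ => (p.1, p.2 - ∑ j, p.1 j)) :=
    (MeasurePreserving.id volume).skew_product (g := fun (v : Fin m → ℝ) x => x - ∑ j, v j) (by fun_prop)
      (ae_of_all _ fun v : Fin m → ℝ => (measurePreserving_sub_right volume (∑ j, v j)).map_eq)
  have h2 : MeasurePreserving (Prod.swap : (Fin m → ℝ) × ℝ → ℝ × (Fin m → ℝ)) :=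
    Measure.measurePreserving_swap
  have h3 := (volume_preserving_piFinSuccAbove (fun _ : Fin (m + 1) => ℝ) (Fin.last m)).symm
  have h4 := h3.comp (h2.comp h1)
  convert h4 using 1
  funext p
  simp [MeasurableEquiv.piFinSuccAbove, Fin.insertNthEquiv, Fin.insertNth_last']

/-- Integration of a homogeneous function times an exponential over the orthant, in terms of the
simplex. -/
theorem integral_orthant_eq_simplex {m : ℕ} {F : (Fin (m + 1) → ℝ) → ℂ} (hF : Measurable F)
    (hint : IntegrableOn F (orthant (m + 1))) {H : (Fin m → ℝ) → ℂ}
    (hH : ∀ l : ℝ, 0 < l → ∀ u : Fin m → ℝ,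
      F (fun j => l * (Fin.snoc u (1 - ∑ i, u i) : Fin (m + 1) → ℝ) j) =
        Real.exp (-(2 * Real.pi) * l) * ((l : ℂ) ^ m)⁻¹ * H u) :
    IntegrableOn H {u | (∀ i, 0 ≤ u i) ∧ ∑ i, u i ≤ 1} ∧
      ∫ s in orthant (m + 1), F s =
        (2 * Real.pi : ℂ)⁻¹ * ∫ u in {u | (∀ i, 0 ≤ u i) ∧ ∑ i, u i ≤ 1}, H u := by
  set Q : Set (Fin (m + 1) → ℝ) := {s | ∀ j, 0 ≤ s j} with hQ
  set S : Set (Fin m → ℝ) := {u | (∀ i, 0 ≤ u i) ∧ ∑ i, u i ≤ 1} with hS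
  have hQm : MeasurableSet Q := by
    rw [hQ]; measurability
  have hSm : MeasurableSet S := by
    rw [hS]; measurability
  set T := fun p : (Fin m → ℝ) × ℝ => (Fin.snoc p.1 (p.2 - ∑ j, p.1 j) : Fin (m + 1) → ℝ) with hT
  have hTm : MeasurePreserving T := measurePreserving_snoc_sub_sum m
  set g := Q.indicator F with hg
  have hgm : Measurable g := hF.indicator hQm
  have hgint : Integrable g := by
    rw [hg, integrable_indicator_iff hQm]
    exact hint.congr_set_ae (orthant_ae_eq _).symm
  have hgT : Integrable (g ∘ T) (volume.prod volume) :=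
    (hTm.integrable_comp hgm.aestronglyMeasurable).2 hgint
  have hscale : ∀ l : ℝ, 0 < l → ∀ u : Fin m → ℝ, g (T (l • u, l)) =
      Real.exp (-(2 * Real.pi) * l) * ((l : ℂ) ^ m)⁻¹ * S.indicator H u := by
    intro l hl u
    have h1 : T (l • u, l) = fun j => l * (Fin.snoc u (1 - ∑ i, u i) : Fin (m + 1) → ℝ) j := by
      funext j
      refine Fin.lastCases ?_ (fun i => ?_) j
      · simp [hT, mul_sub, Finset.mul_sum]
      · simp [hT]
    have h2 : T (l • u, l) ∈ Q ↔ u ∈ S := by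
      rw [h1, hQ, hS]
      simp only [Set.mem_ofPred_eq, Fin.forall_fin_succ', Fin.snoc_castSucc, Fin.snoc_last,
        mul_nonneg_iff_of_pos_left hl, sub_nonneg]
    by_cases hu : u ∈ S
    · rw [hg, Set.indicator_of_mem (h2.2 hu), Set.indicator_of_mem hu, h1, hH l hl]
    · rw [hg, Set.indicator_of_notMem (mt h2.1 hu), Set.indicator_of_notMem hu, mul_zero]
  have hneg : ∀ l : ℝ, l < 0 → ∀ v : Fin m → ℝ, g (T (v, l)) = 0 := by
    intro l hl v
    refine Set.indicator_of_notMem (fun hmem => ?_) _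
    have h1 : ∀ i, 0 ≤ v i := fun i => by simpa [hT] using hmem i.castSucc
    have h2 : 0 ≤ l - ∑ j, v j := by simpa [hT] using hmem (Fin.last m)
    have := Finset.sum_nonneg fun i (_ : i ∈ Finset.univ) => h1 i
    linarith
  -- The Jacobian `l ^ m` of `v = l u` cancels the homogeneity factor of `F`.
  have hinner : ∀ l : ℝ, 0 < l → ∫ v, g (T (v, l)) =
      Real.exp (-(2 * Real.pi) * l) * ∫ u in S, H u := by
    intro l hl
    have h1 := Measure.integral_comp_smul (volume : Measure (Fin m → ℝ)) (fun v => g (T (v, l))) l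
    simp only [hscale l hl, integral_const_mul, integral_indicator hSm, Module.finrank_fin_fun] at h1
    rw [abs_of_pos (by positivity), real_smul] at h1
    have h2 : (l : ℂ) ^ m ≠ 0 := by
      have : (l : ℂ) ≠ 0 := by exact_mod_cast hl.ne'
      positivity
    push_cast at h1 ⊢
    field_simp at h1
    rw [← h1, neg_mul]
  constructor
  -- By Fubini almost every slice is integrable, and a slice with `l > 0` is a nonzero multiple of
  -- `H` after rescaling.
  · have h1 := hgT.prod_left_ae
    have h2 : ∀ᵐ l ∂(volume.restrict (Set.Ioi (0 : ℝ))), Integrable fun v => (g ∘ T) (v, l) :=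
      ae_restrict_of_ae h1
    have h3 : ∀ᵐ l ∂(volume.restrict (Set.Ioi (0 : ℝ))), l ∈ Set.Ioi (0 : ℝ) :=
      ae_restrict_mem measurableSet_Ioi
    have : (ae (volume.restrict (Set.Ioi (0 : ℝ)))).NeBot := by
      rw [ae_neBot]
      simp
    obtain ⟨l, h4, hl : 0 < l⟩ := (h2.and h3).exists
    have h5 := h4.comp_smul hl.ne'
    simp only [Function.comp, hscale l hl] at h5
    have h6 : (Real.exp (-(2 * Real.pi) * l) * ((l : ℂ) ^ m)⁻¹ : ℂ) ≠ 0 := by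
      have : (l : ℂ) ≠ 0 := by exact_mod_cast hl.ne'
      exact mul_ne_zero (by exact_mod_cast (Real.exp_pos _).ne') (inv_ne_zero (pow_ne_zero _ this))
    rw [← integrable_indicator_iff hSm]
    exact (integrable_const_mul_iff h6.isUnit _).1 h5
  · have h1 : ∫ s in orthant (m + 1), F s = ∫ p, g (T p) := by
      rw [setIntegral_congr_set (orthant_ae_eq _), ← integral_indicator hQm, ← hTm.map_eq,
        integral_map hTm.measurable.aemeasurable hgm.aestronglyMeasurable]
    rw [h1, Measure.volume_eq_prod, integral_prod_symm (fun p => g (T p)) hgT]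
    have h2 : ∀ᵐ l : ℝ, ∫ v, g (T (v, l)) = (Set.Ioi (0 : ℝ)).indicator
        (fun l => (Real.exp (-(2 * Real.pi) * l) : ℂ) * ∫ u in S, H u) l := by
      filter_upwards [Measure.ae_ne volume (0 : ℝ)] with l hl
      rcases lt_or_gt_of_ne hl with h | h
      · simp [hneg l h, not_lt.2 h.le]
      · rw [Set.indicator_of_mem (by exact h), hinner l h]
    rw [integral_congr_ae h2, integral_indicator measurableSet_Ioi, integral_mul_const]
    congr 1
    have h3 : ∫ l in Set.Ioi (0 : ℝ), (Real.exp (-(2 * Real.pi) * l) : ℂ) =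
        ((∫ l in Set.Ioi (0 : ℝ), Real.exp (-(2 * Real.pi) * l) : ℝ) : ℂ) := integral_ofReal
    rw [h3, integral_exp_mul_Ioi (by simp [Real.pi_pos])]
    simp

theorem barycentric_succ {m : ℕ} (u : Fin m → ℝ) (j : Fin (m + 1)) :
    barycentric (m + 1) u j = (Fin.snoc u (1 - ∑ i, u i) : Fin (m + 1) → ℝ) j := by
  refine Fin.lastCases ?_ (fun i => ?_) j
  · simp [barycentric]
  · simp [barycentric]

theorem integrableOn_simplexIntegrand_and_integral {n : ℕ} (hn : 1 ≤ n) {a : Fin n → ℂ}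
    (ha : a ∈ lift n) :
    IntegrableOn (simplexIntegrand n fun j => exp (a j)) (simplex n) ∧
      coreIntegral n a (fun j => exp (a j)) = (2 * Real.pi : ℂ)⁻¹ * ((∏ j, exp (a j))⁻¹ *
        ∫ u in simplex n, simplexIntegrand n (fun j => exp (a j)) u) := by
  obtain ⟨m, rfl⟩ : ∃ m, n = m + 1 := ⟨n - 1, by omega⟩
  have hP : (∏ j, exp (a j))⁻¹ ≠ 0 := inv_ne_zero (Finset.prod_ne_zero_iff.2 fun j _ => exp_ne_zero _)
  set F : (Fin (m + 1) → ℝ) → ℂ := fun s => (∏ j, exp (a j))⁻¹ *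
    (exp (-(2 * Real.pi) * ∑ j, (s j : ℂ)) * (∏ i : Fin (m + 1 - 1),
      ((s (lo i) : ℂ) / exp (a (lo i)) - (s (hi i) : ℂ) / exp (a (hi i))))⁻¹) with hF
  have hFm : Measurable F := by
    rw [hF]
    fun_prop
  have hcore : ∀ y : Fin (m + 1) → ℝ, core (m + 1) a (fun j => exp (a j)) y =
      (∏ j, exp ((1 : ℝ) * y j)) * F fun j => Real.exp (1 * y j) := core_exp_eq a
  have hint : IntegrableOn F (orthant (m + 1)) := by
    rw [integrableOn_orthant_iff (c := 1) (by simp)]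
    simp only [← hcore]
    exact integrable_core hn (admissible_of_mem_sector (mem_sector_self ha))
  have hK : coreIntegral (m + 1) a (fun j => exp (a j)) = ∫ s in orthant (m + 1), F s := by
    rw [integral_orthant (c := 1) (by simp)]
    simp only [← hcore]
    rfl
  have hscale : ∀ l : ℝ, 0 < l → ∀ u : Fin m → ℝ,
      F (fun j => l * (Fin.snoc u (1 - ∑ i, u i) : Fin (m + 1) → ℝ) j) =
        Real.exp (-(2 * Real.pi) * l) * ((l : ℂ) ^ m)⁻¹ *
          ((∏ j, exp (a j))⁻¹ * simplexIntegrand (m + 1) (fun j => exp (a j)) u) := by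
    intro l hl u
    have hsum : ∑ j, (barycentric (m + 1) u j : ℂ) = 1 := by
      simp only [barycentric_succ, Fin.sum_univ_castSucc, Fin.snoc_castSucc, Fin.snoc_last]
      push_cast
      ring
    simp only [hF, simplexIntegrand, ← barycentric_succ, ofReal_mul, ← Finset.mul_sum, hsum,
      mul_div_assoc, ← mul_sub, Finset.prod_mul_distrib, Finset.prod_const, Finset.card_univ,
      Fintype.card_fin, mul_inv, ofReal_exp, Nat.add_sub_cancel]
    have hE : exp (-(2 * Real.pi) * (l * 1)) = exp ((-(2 * Real.pi) : ℝ) * (l : ℂ)) := by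
      push_cast
      ring_nf
    have key : ∀ P E L X : ℂ, P * (E * (L * X)) = E * L * (P * X) := fun P E L X => by ring
    rw [hE]
    exact key _ _ _ _
  obtain ⟨h1, h2⟩ := integral_orthant_eq_simplex hFm hint hscale
  refine ⟨(integrable_const_mul_iff hP.isUnit _).1 h1, ?_⟩
  rw [hK, h2]
  congr 1
  exact integral_const_mul _ _

theorem rayJ_exp_eq_simplexJ {n : ℕ} (hn : 1 ≤ n) {a : Fin n → ℂ} (ha : a ∈ lift n) :
    rayJ n (fun j => exp (a j)) = simplexJ n fun j => exp (a j) := by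
  rw [rayJ_exp hn, (integrableOn_simplexIntegrand_and_integral hn ha).2, simplexJ, prefactor]
  have hpi : (Real.pi : ℂ) ≠ 0 := by exact_mod_cast Real.pi_ne_zero
  field_simp

/-! ### The tube of logarithms over `D_n` -/

theorem exp_mem_domain {n : ℕ} {a : Fin n → ℂ} (ha : a ∈ lift n) :
    (fun j => exp (a j)) ∈ domain n := by
  refine ⟨fun j => exp_ne_zero _, ?_⟩
  rintro i ⟨r, hr, h⟩
  have h' : exp (a (hi i) - a (lo i)) = r := by rw [exp_sub]; exact h
  have hr0 : 0 < r := by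
    refine lt_of_le_of_ne hr ?_
    rintro rfl
    exact exp_ne_zero _ (h'.trans ofReal_zero)
  refine exp_ne_exp_of_im_sub (p := a (hi i) - a (lo i)) (q := (Real.log r : ℂ)) ?_ ?_ ?_
  · rw [sub_im _ (Real.log r : ℂ), ofReal_im, sub_zero]
    exact (ha i).1
  · rw [sub_im _ (Real.log r : ℂ), ofReal_im, sub_zero]
    exact (ha i).2
  · rw [h', ← ofReal_exp, Real.exp_log hr0]

/-- A tuple with prescribed first entry and prescribed increments. -/
theorem exists_increments {M : Type*} [AddCommGroup M] (n : ℕ) (x : M) (g : Fin (n - 1) → M) :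
    ∃ b : Fin n → M, (∀ h : 0 < n, b ⟨0, h⟩ = x) ∧ ∀ i : Fin (n - 1), b (hi i) = b (lo i) + g i := by
  refine ⟨fun j => Nat.rec x (fun k y => y + if h : k < n - 1 then g ⟨k, h⟩ else 0) (j : ℕ),
    fun _ => rfl, fun i => ?_⟩
  simp

theorem exists_logs {n : ℕ} (hn : 1 ≤ n) {z : Fin n → ℂ} (hz : z ∈ torus n) {g : Fin (n - 1) → ℂ}
    (hg : ∀ i, exp (g i) = z (hi i) / z (lo i)) :
    ∃ b : Fin n → ℂ, (∀ j, exp (b j) = z j) ∧ ∀ i, b (hi i) = b (lo i) + g i := by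
  obtain ⟨b, hb0, hb⟩ := exists_increments n (log (z ⟨0, hn⟩)) g
  refine ⟨b, ?_, hb⟩
  have : ∀ (k : ℕ) (hk : k < n), exp (b ⟨k, hk⟩) = z ⟨k, hk⟩ := by
    intro k
    induction k with
    | zero => intro hk; rw [hb0, exp_log (hz _)]
    | succ k ih =>
      intro hk
      have h1 := hb ⟨k, by omega⟩
      simp only [hi, lo] at h1
      rw [h1, exp_add, ih (by omega), hg]
      exact mul_div_cancel₀ _ (hz _)
  exact fun j => this j j.2

theorem exp_log_neg_add {q : ℂ} (hq : q ≠ 0) : exp (log (-q) + Real.pi * I) = q := by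
  rw [exp_add, exp_log (neg_ne_zero.2 hq), exp_pi_mul_I]
  ring

theorem exp_log_neg_sub {q : ℂ} (hq : q ≠ 0) : exp (log (-q) - Real.pi * I) = q := by
  rw [exp_sub, exp_log (neg_ne_zero.2 hq), exp_pi_mul_I]
  ring

/-- The logarithm `log (-q) + πi` of a quotient `q` has imaginary part in `(0, 2π]`, and the value
`2π` occurs only for positive `q`. -/
theorem exists_lift {n : ℕ} (hn : 1 ≤ n) {z : Fin n → ℂ} (hz : z ∈ domain n) :
    ∃ a ∈ lift n, ∀ j, exp (a j) = z j := by
  have hq : ∀ i : Fin (n - 1), z (hi i) / z (lo i) ≠ 0 := fun i => div_ne_zero (hz.1 _) (hz.1 _)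
  obtain ⟨b, hb, hb'⟩ := exists_logs hn hz.1
    (g := fun i => log (-(z (hi i) / z (lo i))) + Real.pi * I) (fun i => exp_log_neg_add (hq i))
  refine ⟨b, fun i => ?_, hb⟩
  rw [hb', add_sub_cancel_left]
  have h1 := neg_pi_lt_arg (-(z (hi i) / z (lo i)))
  have h2 := arg_le_pi (-(z (hi i) / z (lo i)))
  have h3 : arg (-(z (hi i) / z (lo i))) ≠ Real.pi := by
    intro h
    rw [arg_eq_pi_iff] at h
    refine hz.2 i ⟨(z (hi i) / z (lo i)).re, ?_, ?_⟩
    · have := h.1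
      rw [neg_re] at this
      linarith
    · refine Complex.ext (by simp) ?_
      have := h.2
      rw [neg_im] at this
      rw [ofReal_im]
      linarith
  have h4 : (log (-(z (hi i) / z (lo i))) + Real.pi * I).im = arg (-(z (hi i) / z (lo i))) + Real.pi := by
    simp [log_im]
  rw [h4]
  constructor
  · linarith
  · linarith [lt_of_le_of_ne h2 h3]

/-- The directions stay frozen at `a` while the weights move: near `exp a` the rays adapted to `z`
can be rotated back to those of `a`. Holomorphy in `z` and the differential of `J_n` are read off
from this formula. -/
theorem eventually_rayJ_eq {n : ℕ} (hn : 1 ≤ n) {a : Fin n → ℂ} (ha : a ∈ lift n) :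
    ∀ᶠ z in 𝓝 (fun j => exp (a j)), z ∈ domain n ∧
      rayJ n z = prefactor n * (∑ j, z j) * coreIntegral n a z := by
  set z₀ : Fin n → ℂ := fun j => exp (a j) with hz₀
  have hne : ∀ j, z₀ j ≠ 0 := fun j => exp_ne_zero _
  have hcont : ContinuousAt (fun (z : Fin n → ℂ) j => a j + log (z j / z₀ j)) z₀ := by
    refine continuousAt_pi.2 fun j => ContinuousAt.add continuousAt_const ?_
    refine ContinuousAt.clog ((continuous_apply j).continuousAt.div_const _) ?_
    rw [div_self (hne j)]
    exact one_mem_slitPlane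
  have hval : (fun j => a j + log (z₀ j / z₀ j)) = a := by
    funext j
    simp [div_self (hne j)]
  have hlift : ∀ᶠ z in 𝓝 z₀, (fun j => a j + log (z j / z₀ j)) ∈ lift n := by
    refine hcont.eventually ?_
    simp only [hval]
    exact (isOpen_lift n).mem_nhds ha
  have hsec : ∀ᶠ z in 𝓝 z₀, ∀ j, -(Real.pi / 2) < (log (z j / z₀ j)).im ∧
      (log (z j / z₀ j)).im < Real.pi / 2 := by
    refine eventually_all.2 fun j => ?_
    have hc : ContinuousAt (fun z : Fin n → ℂ => (log (z j / z₀ j)).im) z₀ := by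
      refine continuous_im.continuousAt.comp (ContinuousAt.clog ((continuous_apply j).continuousAt.div_const _) ?_)
      rw [div_self (hne j)]
      exact one_mem_slitPlane
    have h0 : (log (z₀ j / z₀ j)).im = 0 := by simp [div_self (hne j)]
    have hpi : 0 < Real.pi / 2 := by positivity
    exact (hc.tendsto.eventually_const_lt (by rw [h0]; linarith)).and
      (hc.tendsto.eventually_lt_const (by rw [h0]; linarith))
  have htor : ∀ᶠ z in 𝓝 z₀, ∀ j, z j ≠ 0 :=
    eventually_all.2 fun j => (continuous_apply j).continuousAt.eventually_ne (hne j)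
  filter_upwards [hlift, hsec, htor] with z h1 h2 h3
  set b : Fin n → ℂ := fun j => a j + log (z j / z₀ j) with hb
  have hz : z = fun j => exp (b j) := by
    funext j
    rw [hb]
    simp only
    rw [exp_add, exp_log (div_ne_zero (h3 j) (hne j))]
    exact (mul_div_cancel₀ _ (hne j)).symm
  have hab : a ∈ sector n b := ⟨ha, fun j => by simpa [hb] using h2 j⟩
  rw [hz]
  refine ⟨exp_mem_domain h1, ?_⟩
  rw [rayJ_exp hn, coreIntegral_eq_of_mem_sector hn (mem_sector_self h1) hab]

theorem isOpen_domain {n : ℕ} (hn : 1 ≤ n) : IsOpen (domain n) := by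
  refine isOpen_iff_mem_nhds.2 fun z hz => ?_
  obtain ⟨a, ha, haz⟩ := exists_lift hn hz
  obtain rfl : (fun j => exp (a j)) = z := funext haz
  filter_upwards [eventually_rayJ_eq hn ha] with z h using h.1

theorem differentiableAt_rayJ {n : ℕ} (hn : 1 ≤ n) {z : Fin n → ℂ} (hz : z ∈ domain n) :
    DifferentiableAt ℂ (rayJ n) z := by
  obtain ⟨a, ha, haz⟩ := exists_lift hn hz
  obtain rfl : (fun j => exp (a j)) = z := funext haz
  obtain ⟨L, hL, -⟩ := hasFDerivAt_coreIntegral_right hn (admissible_of_mem_sector (mem_sector_self ha))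
  have h1 := hL.differentiableAt
  refine DifferentiableAt.congr_of_eventuallyEq (f := fun z => prefactor n * (∑ j, z j) * coreIntegral n a z) (by fun_prop) ?_
  filter_upwards [eventually_rayJ_eq hn ha] with z h using h.2

/-! ### Boundary values -/

theorem eventually_gap {x m : ℝ} (h : (0 < x ∧ x < 2 * Real.pi) ∨ (x = 0 ∧ 0 < m) ∨
    (x = 2 * Real.pi ∧ m < 0)) :
    ∀ᶠ ε in 𝓝[>] (0 : ℝ), 0 < x + ε * m ∧ x + ε * m < 2 * Real.pi := by
  have hpi : 0 < 2 * Real.pi := by positivity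
  have hc : Tendsto (fun ε : ℝ => x + ε * m) (𝓝[>] (0 : ℝ)) (𝓝 x) := by
    have : ContinuousAt (fun ε : ℝ => x + ε * m) 0 := by fun_prop
    simpa [ContinuousAt] using this.tendsto.mono_left nhdsWithin_le_nhds
  rcases h with ⟨h1, h2⟩ | ⟨rfl, hm⟩ | ⟨rfl, hm⟩
  · exact (hc.eventually_const_lt h1).and (hc.eventually_lt_const h2)
  · refine Filter.Eventually.and ?_ (hc.eventually_lt_const hpi)
    filter_upwards [self_mem_nhdsWithin] with ε hε
    rw [zero_add]
    exact mul_pos hε hm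
  · refine Filter.Eventually.and (hc.eventually_const_lt hpi) ?_
    filter_upwards [self_mem_nhdsWithin] with ε hε
    have := mul_neg_of_pos_of_neg (show 0 < ε from hε) hm
    linarith

theorem exists_tilted_lift {n : ℕ} (hn : 1 ≤ n) {z : Fin n → ℂ} (hz : z ∈ torus n)
    (τ : Equiv.Perm (Fin n)) :
    ∃ b : Fin n → ℂ, (∀ j, exp (b j) = z j) ∧
      ∀ᶠ ε : ℝ in 𝓝[>] (0 : ℝ), (fun j => b j + I * ε * ((τ j : ℕ) : ℂ)) ∈ lift n := by
  -- On a wall the limiting gap may be taken as `0` or as `2π`; the sign of `τ (hi i) - τ (lo i)`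
  -- decides from which end the rotation moves it into the interval.
  have hgap : ∀ i : Fin (n - 1), ∃ g : ℂ, exp g = z (hi i) / z (lo i) ∧
      ∀ᶠ ε in 𝓝[>] (0 : ℝ), 0 < g.im + ε * (((τ (hi i) : ℕ) : ℝ) - ((τ (lo i) : ℕ) : ℝ)) ∧
        g.im + ε * (((τ (hi i) : ℕ) : ℝ) - ((τ (lo i) : ℕ) : ℝ)) < 2 * Real.pi := by
    intro i
    have hq : z (hi i) / z (lo i) ≠ 0 := div_ne_zero (hz _) (hz _)
    have h1 := neg_pi_lt_arg (-(z (hi i) / z (lo i)))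
    have h2 := arg_le_pi (-(z (hi i) / z (lo i)))
    have hp : (log (-(z (hi i) / z (lo i))) + Real.pi * I).im = arg (-(z (hi i) / z (lo i))) + Real.pi := by
      simp [log_im]
    have hm : (log (-(z (hi i) / z (lo i))) - Real.pi * I).im = arg (-(z (hi i) / z (lo i))) - Real.pi := by
      simp [log_im]
    rcases lt_or_eq_of_le h2 with h3 | h3
    · exact ⟨_, exp_log_neg_add hq, eventually_gap (Or.inl (by rw [hp]; constructor <;> linarith))⟩
    have hne : τ (hi i) ≠ τ (lo i) := fun h => by
      have := Fin.ext_iff.1 (τ.injective h)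
      simp at this
    rcases lt_or_gt_of_ne hne with h | h
    · refine ⟨_, exp_log_neg_add hq, eventually_gap (Or.inr (Or.inr ⟨by rw [hp, h3]; ring, ?_⟩))⟩
      rw [sub_neg]
      exact_mod_cast h
    · refine ⟨_, exp_log_neg_sub hq, eventually_gap (Or.inr (Or.inl ⟨by rw [hm, h3]; ring, ?_⟩))⟩
      rw [sub_pos]
      exact_mod_cast h
  choose g hg hg' using hgap
  obtain ⟨b, hb, hb'⟩ := exists_logs hn hz hg
  refine ⟨b, hb, ?_⟩
  filter_upwards [eventually_all.2 hg'] with ε hε i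
  have : (b (hi i) + I * ε * ((τ (hi i) : ℕ) : ℂ) - (b (lo i) + I * ε * ((τ (lo i) : ℕ) : ℂ))).im =
      (g i).im + ε * (((τ (hi i) : ℕ) : ℝ) - ((τ (lo i) : ℕ) : ℝ)) := by
    rw [hb']
    simp
    ring
  simp only
  rw [this]
  exact hε i

theorem tendsto_tilt (n : ℕ) (z : Fin n → ℂ) (τ : Equiv.Perm (Fin n)) :
    Tendsto (fun ε => tilt n z τ ε) (𝓝[>] (0 : ℝ)) (𝓝 z) := by
  have : Continuous (fun ε : ℝ => tilt n z τ ε) := by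
    unfold tilt
    fun_prop
  have h := (this.tendsto 0).mono_left (nhdsWithin_le_nhds (s := Set.Ioi 0))
  have h0 : tilt n z τ 0 = z := by
    funext j
    simp [tilt]
  rwa [h0] at h

/-- Directions tilted by one fixed small `δ` serve all `ε < δ` and the limit point itself: the rays
stay apart, and `δ n < π / 2` keeps the exponentials decaying. The boundary value is thus the value
of a function continuous at `z`. -/
theorem exists_directions_tilt {n : ℕ} (hn : 1 ≤ n) {z : Fin n → ℂ} (hz : z ∈ torus n)
    (τ : Equiv.Perm (Fin n)) :
    ∃ a : Fin n → ℂ, Admissible n a z ∧ ∀ᶠ ε in 𝓝[>] (0 : ℝ), tilt n z τ ε ∈ domain n ∧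
      rayJ n (tilt n z τ ε) =
        prefactor n * (∑ j, tilt n z τ ε j) * coreIntegral n a (tilt n z τ ε) := by
  obtain ⟨b, hb, hlift⟩ := exists_tilted_lift hn hz τ
  have hn0 : (0 : ℝ) < n := by exact_mod_cast hn
  have hpi := Real.pi_pos
  have hsmall : ∀ᶠ ε in 𝓝[>] (0 : ℝ), ε < Real.pi / 2 / n :=
    nhdsWithin_le_nhds (eventually_lt_nhds (by positivity))
  obtain ⟨δ, ⟨hδ1, hδ2⟩, hδ : 0 < δ⟩ := ((hlift.and hsmall).and self_mem_nhdsWithin).exists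
  rw [lt_div_iff₀ hn0] at hδ2
  have hsec : ∀ ε : ℝ, 0 ≤ ε → ε ≤ δ → (fun j => b j + I * δ * ((τ j : ℕ) : ℂ)) ∈
      sector n (fun j => b j + I * ε * ((τ j : ℕ) : ℂ)) := by
    intro ε h0 h1
    refine ⟨hδ1, fun j => ?_⟩
    have him : (b j + I * ε * ((τ j : ℕ) : ℂ) - (b j + I * δ * ((τ j : ℕ) : ℂ))).im =
        -((δ - ε) * ((τ j : ℕ) : ℝ)) := by
      simp
      ring
    have ht : ((τ j : ℕ) : ℝ) ≤ n := by exact_mod_cast (τ j).2.le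
    have ht0 : (0 : ℝ) ≤ ((τ j : ℕ) : ℝ) := by positivity
    have h2 : 0 ≤ (δ - ε) * ((τ j : ℕ) : ℝ) := mul_nonneg (by linarith) ht0
    have h3 : (δ - ε) * ((τ j : ℕ) : ℝ) ≤ δ * n := mul_le_mul (by linarith) ht ht0 hδ.le
    simp only
    rw [him]
    constructor <;> linarith
  refine ⟨fun j => b j + I * δ * ((τ j : ℕ) : ℂ), ?_, ?_⟩
  · have := admissible_of_mem_sector (hsec 0 le_rfl hδ.le)
    simpa [hb] using this
  · filter_upwards [hlift, self_mem_nhdsWithin, nhdsWithin_le_nhds (eventually_lt_nhds hδ)] with ε h1 h2 h3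
    have htilt : tilt n z τ ε = fun j => exp (b j + I * ε * ((τ j : ℕ) : ℂ)) := by
      funext j
      rw [exp_add, hb, tilt]
    rw [htilt]
    refine ⟨exp_mem_domain h1, ?_⟩
    rw [rayJ_exp hn, coreIntegral_eq_of_mem_sector hn (mem_sector_self h1) (hsec ε (le_of_lt h2) h3.le)]

theorem eventually_tilt_mem_domain {n : ℕ} (hn : 1 ≤ n) {z : Fin n → ℂ} (hz : z ∈ torus n)
    (τ : Equiv.Perm (Fin n)) : ∀ᶠ ε in 𝓝[>] (0 : ℝ), tilt n z τ ε ∈ domain n := by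
  obtain ⟨a, -, h⟩ := exists_directions_tilt hn hz τ
  exact h.mono fun _ h => h.1

theorem exists_tendsto_rayJ_tilt {n : ℕ} (hn : 1 ≤ n) {z : Fin n → ℂ} (hz : z ∈ torus n)
    (τ : Equiv.Perm (Fin n)) :
    ∃ l : ℂ, Tendsto (fun ε => rayJ n (tilt n z τ ε)) (𝓝[>] (0 : ℝ)) (𝓝 l) := by
  obtain ⟨a, ha, h⟩ := exists_directions_tilt hn hz τ
  obtain ⟨L, hL, -⟩ := hasFDerivAt_coreIntegral_right hn ha
  have hL' := hL.continuousAt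
  have hc : ContinuousAt (fun z : Fin n → ℂ => prefactor n * (∑ j, z j) * coreIntegral n a z) z := by
    fun_prop
  refine ⟨_, (hc.tendsto.comp (tendsto_tilt n z τ)).congr' ?_⟩
  filter_upwards [h] with ε hε using hε.2.symm

theorem tendsto_rayJ_tilt {n : ℕ} (hn : 1 ≤ n) {z : Fin n → ℂ} (hz : z ∈ torus n)
    (τ : Equiv.Perm (Fin n)) :
    Tendsto (fun ε => rayJ n (tilt n z τ ε)) (𝓝[>] (0 : ℝ))
      (𝓝 (limUnder (𝓝[>] (0 : ℝ)) fun ε => rayJ n (tilt n z τ ε))) :=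
  tendsto_nhds_limUnder (exists_tendsto_rayJ_tilt hn hz τ)

theorem J_eq_rayJ {n : ℕ} {z : Fin n → ℂ} (hz : z ∈ domain n) : J n z = rayJ n z := if_pos hz

/-- On `D_n` all boundary values equal `rayJ n z` by continuity, so the averaged formula holds
everywhere and spares case distinctions. -/
theorem J_eq_wallJ {n : ℕ} (hn : 1 ≤ n) (z : Fin n → ℂ) : J n z = wallJ n z := by
  by_cases h : z ∈ domain n
  · rw [J_eq_rayJ h, wallJ]
    have hlim : ∀ τ : Equiv.Perm (Fin n),
        limUnder (𝓝[>] (0 : ℝ)) (fun ε => rayJ n (tilt n z τ ε)) = rayJ n z := fun τ =>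
      ((differentiableAt_rayJ hn h).continuousAt.tendsto.comp (tendsto_tilt n z τ)).limUnder_eq
    simp only [hlim, Finset.sum_const, Finset.card_univ, Fintype.card_perm, Fintype.card_fin,
      nsmul_eq_mul]
    rw [mul_div_cancel_left₀]
    exact_mod_cast n.factorial_ne_zero
  · exact if_neg h

/-! ### Growth -/

/-- Small rotations make the gaps between consecutive directions uniformly large. -/
theorem exists_separated {n : ℕ} (hn : 1 ≤ n) {a : Fin n → ℂ} (ha : a ∈ lift n) :
    ∃ e : Fin n → ℝ, (∀ j, |e j| ≤ Real.pi / 4) ∧ ∀ i : Fin (n - 1),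
      Real.pi / (4 * n) ≤ ((a (hi i) + I * e (hi i)) - (a (lo i) + I * e (lo i))).im ∧
      ((a (hi i) + I * e (hi i)) - (a (lo i) + I * e (lo i))).im ≤ 2 * Real.pi - Real.pi / (4 * n) := by
  have hn0 : (1 : ℝ) ≤ n := by exact_mod_cast hn
  have hpi := Real.pi_pos
  set κ := Real.pi / (4 * n) with hκ
  have hκ0 : 0 < κ := by positivity
  have hκn : n * κ = Real.pi / 4 := by rw [hκ]; field_simp
  have hκ1 : κ ≤ Real.pi / 4 := by rw [← hκn]; nlinarith
  set d : Fin (n - 1) → ℝ := fun i => (a (hi i) - a (lo i)).im with hd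
  -- Only gaps within `κ` of an end of `(0, 2π)` are corrected, by `±κ`. The accumulated rotation is
  -- at most `n κ = π / 4`.
  set g : Fin (n - 1) → ℝ := fun i => if d i < κ then κ else if 2 * Real.pi - κ < d i then -κ else 0
    with hg
  have hg1 : ∀ i, |g i| ≤ κ := by
    intro i
    simp only [hg]
    split_ifs <;> simp [abs_of_pos hκ0, hκ0.le]
  have hg2 : ∀ i, κ ≤ d i + g i ∧ d i + g i ≤ 2 * Real.pi - κ := by
    intro i
    have h1 : 0 < d i := (ha i).1
    have h2 : d i < 2 * Real.pi := (ha i).2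
    simp only [hg]
    split_ifs <;> constructor <;> linarith
  obtain ⟨e, he0, he⟩ := exists_increments n (0 : ℝ) g
  have hek : ∀ (k : ℕ) (hk : k < n), |e ⟨k, hk⟩| ≤ k * κ := by
    intro k
    induction k with
    | zero => intro hk; rw [he0]; simp
    | succ k ih =>
      intro hk
      have h1 := he ⟨k, by omega⟩
      simp only [hi, lo] at h1
      rw [h1]
      calc _ ≤ |e ⟨k, by omega⟩| + |g ⟨k, by omega⟩| := abs_add_le _ _
        _ ≤ k * κ + κ := add_le_add (ih (by omega)) (hg1 _)
        _ = _ := by push_cast; ring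
  refine ⟨e, fun j => (hek j j.2).trans ?_, fun i => ?_⟩
  · rw [← hκn]
    have : ((j : ℕ) : ℝ) ≤ n := by exact_mod_cast j.2.le
    gcongr
  · have : ((a (hi i) + I * e (hi i)) - (a (lo i) + I * e (lo i))).im = d i + g i := by
      rw [he]
      simp [hd]
      ring
    rw [this]
    exact hg2 i

/-- After the rotation of `exists_separated` the constants `κ` and `η` depend on `n` alone, and the
real parts of `a` enter the bound only through `exp (-(a j).re / n)`. -/
theorem exists_norm_rayJ_le {n : ℕ} (hn : 1 ≤ n) :
    ∃ C : ℝ, ∀ z ∈ domain n, ‖rayJ n z‖ ≤ C * (‖∑ j, z j‖ * ∏ j, ‖z j‖ ^ (-(1 / n) : ℝ)) := by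
  have hpi := Real.pi_pos
  have hn0 : (1 : ℝ) ≤ n := by exact_mod_cast hn
  set κ := Real.pi / (4 * n) with hκ
  have hκ0 : 0 < κ := by positivity
  have hκ1 : κ ≤ Real.pi / 2 := by
    rw [hκ, div_le_div_iff₀ (by positivity) (by positivity)]
    nlinarith
  set η := Real.cos (Real.pi / 4) with hη
  have hη0 : 0 < η := Real.cos_pos_of_mem_Ioo ⟨by linarith, by linarith⟩
  set B : (Fin n → ℝ) → ℝ := fun y =>
    ∏ j, (Real.exp ((y j - 0) / n) * Real.exp (-(2 * Real.pi * η) * Real.exp (y j))) with hB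
  have hBint : Integrable B := integrable_prod_exp hn (fun _ => 0) (η := fun _ => η) fun _ => hη0
  refine ⟨‖prefactor n‖ * ((Real.sin κ ^ (n - 1))⁻¹ * ∫ y, B y), fun z hz => ?_⟩
  obtain ⟨a, ha, haz⟩ := exists_lift hn hz
  obtain rfl : (fun j => exp (a j)) = z := funext haz
  obtain ⟨e, he1, he2⟩ := exists_separated hn ha
  set a' : Fin n → ℂ := fun j => a j + I * e j with ha'
  have hre : ∀ j, (a' j).re = (a j).re := fun j => by simp [ha']
  have him : ∀ j, (a j - a' j).im = -e j := fun j => by simp [ha']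
  have hsec : a' ∈ sector n a := by
    refine ⟨fun i => ⟨hκ0.trans_le (he2 i).1, (he2 i).2.trans_lt (by linarith)⟩, fun j => ?_⟩
    have := abs_le.1 (he1 j)
    rw [him]
    constructor <;> linarith
  have hcos : ∀ j, η ≤ (exp (a j) * exp (-a' j)).re := by
    intro j
    rw [re_exp_mul_exp_neg, hre, sub_self, Real.exp_zero, one_mul, him, Real.cos_neg, ← Real.cos_abs]
    exact Real.cos_le_cos_of_nonneg_of_le_pi (abs_nonneg _) (by linarith) (he1 j)
  have hnorm : ∀ j, ‖exp (a j)‖ ^ (-(1 / n) : ℝ) = Real.exp (-(a j).re / n) := by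
    intro j
    rw [norm_exp, ← Real.exp_mul]
    ring_nf
  have hK : ‖coreIntegral n a' fun j => exp (a j)‖ ≤
      (Real.sin κ ^ (n - 1))⁻¹ * (∫ y, B y) * ∏ j, ‖exp (a j)‖ ^ (-(1 / n) : ℝ) := by
    rw [coreIntegral]
    have h1 := norm_integral_le_of_norm_le (f := core n a' fun j => exp (a j))
      (hBint.const_mul ((Real.sin κ ^ (n - 1))⁻¹ * ∏ j, ‖exp (a j)‖ ^ (-(1 / n) : ℝ)))
      (ae_of_all _ fun y => ?_)
    · rw [integral_const_mul] at h1
      calc _ ≤ _ := h1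
        _ = _ := by ring
    · refine (norm_core_le hn hκ0 hκ1 he2 hcos y).trans (le_of_eq ?_)
      rw [mul_assoc (Real.sin κ ^ (n - 1))⁻¹, hB]
      congr 1
      rw [← Finset.prod_mul_distrib]
      refine Finset.prod_congr rfl fun j _ => ?_
      rw [hnorm, hre]
      simp only [← Real.exp_add]
      ring_nf
  rw [rayJ_exp hn, coreIntegral_eq_of_mem_sector hn (mem_sector_self ha) hsec, norm_mul, norm_mul]
  calc _ ≤ ‖prefactor n‖ * ‖∑ j, exp (a j)‖ * ((Real.sin κ ^ (n - 1))⁻¹ * (∫ y, B y) *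
        ∏ j, ‖exp (a j)‖ ^ (-(1 / n) : ℝ)) := by gcongr
    _ = _ := by ring

theorem exists_norm_J_le {n : ℕ} (hn : 1 ≤ n) :
    ∃ C : ℝ, ∀ z ∈ torus n, ‖J n z‖ ≤ C * (‖∑ j, z j‖ * ∏ j, ‖z j‖ ^ (-(1 / n) : ℝ)) := by
  obtain ⟨C, hC⟩ := exists_norm_rayJ_le hn
  refine ⟨C, fun z hz => ?_⟩
  set R := C * (‖∑ j, z j‖ * ∏ j, ‖z j‖ ^ (-(1 / n) : ℝ)) with hR
  have hlim : ∀ τ : Equiv.Perm (Fin n),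
      ‖limUnder (𝓝[>] (0 : ℝ)) (fun ε => rayJ n (tilt n z τ ε))‖ ≤ R := by
    intro τ
    have hc : ContinuousAt (fun z : Fin n → ℂ =>
        C * (‖∑ j, z j‖ * ∏ j, ‖z j‖ ^ (-(1 / n) : ℝ))) z := by
      refine ContinuousAt.mul continuousAt_const (ContinuousAt.mul (by fun_prop) ?_)
      refine tendsto_finsetProd _ fun j _ => ?_
      exact ((continuous_apply j).norm.continuousAt (x := z)).rpow_const (Or.inl (norm_ne_zero_iff.2 (hz j)))
    refine le_of_tendsto_of_tendsto (tendsto_rayJ_tilt hn hz τ).norm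
      (hc.tendsto.comp (tendsto_tilt n z τ)) ?_
    filter_upwards [eventually_tilt_mem_domain hn hz τ] with ε hε using hC _ hε
  rw [J_eq_wallJ hn, wallJ, norm_div, norm_natCast, div_le_iff₀ (by exact_mod_cast n.factorial_pos)]
  calc _ ≤ ∑ τ : Equiv.Perm (Fin n), R := norm_sum_le_of_le _ fun τ _ => hlim τ
    _ = _ := by simp [Fintype.card_perm, mul_comm]

theorem update_mem_torus {n : ℕ} {z : Fin n → ℂ} (hz : z ∈ torus n) (k : Fin n) {w : ℂ}
    (hw : w ≠ 0) : Function.update z k w ∈ torus n := by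
  intro i
  by_cases h : i = k
  · subst h; simpa using hw
  · simpa [h] using hz i

theorem J_one {z : Fin 1 → ℂ} (hz : z ∈ torus 1) : J 1 z = 1 / (2 * Real.pi * I) := by
  have hd : z ∈ domain 1 := ⟨hz, fun i => absurd i.2 (by omega)⟩
  obtain ⟨a, ha, haz⟩ := exists_lift le_rfl hd
  obtain rfl : (fun j => exp (a j)) = z := funext haz
  rw [J_eq_rayJ hd, rayJ_exp_eq_simplexJ le_rfl ha, simplexJ]
  have h1 : ∫ u in simplex 1, simplexIntegrand 1 (fun j => exp (a j)) u = 1 := by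
    have hs : simplex 1 = Set.univ := by
      ext u
      simp [simplex]
    have hi : simplexIntegrand 1 (fun j => exp (a j)) = fun _ => 1 := by
      funext u
      simp [simplexIntegrand]
    rw [hs, hi]
    simp [measureReal_def, volume_pi]
  rw [h1]
  have hpi : (Real.pi : ℂ) ≠ 0 := by exact_mod_cast Real.pi_ne_zero
  have hI := I_ne_zero
  have := exp_ne_zero (a 0)
  simp
  field_simp
  simp

/-- For `n ≥ 2` the uniform bound leaves `‖w‖ ^ (1 - 1/n)` after multiplication by `‖w‖`; for `n =
1` the function is constant. -/
theorem J_isLittleO {n : ℕ} (hn : 1 ≤ n) {z : Fin n → ℂ} (hz : z ∈ torus n) (k : Fin n) :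
    (fun w : ℂ => J n (Function.update z k w)) =o[𝓝[≠] (0 : ℂ)] (fun w : ℂ => ‖w‖⁻¹) := by
  have hnorm : Tendsto (fun w : ℂ => ‖w‖) (𝓝[≠] 0) (𝓝 0) := by
    have := (continuous_norm (E := ℂ)).tendsto 0
    rw [norm_zero] at this
    exact this.mono_left nhdsWithin_le_nhds
  have hreduce : ∀ {f : ℂ → ℂ}, Tendsto (fun w => ‖f w‖ * ‖w‖) (𝓝[≠] 0) (𝓝 0) →
      f =o[𝓝[≠] (0 : ℂ)] (fun w : ℂ => ‖w‖⁻¹) := by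
    intro f hf
    rw [← isLittleO_norm_left, isLittleO_iff_tendsto']
    · simpa using hf
    · filter_upwards [self_mem_nhdsWithin] with w hw h0
      simp at h0
      exact absurd h0 hw
  refine hreduce ?_
  rcases eq_or_lt_of_le hn with rfl | hn2
  · have : Tendsto (fun w : ℂ => ‖(1 / (2 * Real.pi * I) : ℂ)‖ * ‖w‖) (𝓝[≠] 0) (𝓝 0) := by
      simpa using hnorm.const_mul ‖(1 / (2 * Real.pi * I) : ℂ)‖
    refine this.congr' ?_
    filter_upwards [self_mem_nhdsWithin] with w hw
    rw [J_one (update_mem_torus hz k hw)]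
  · obtain ⟨C, hC⟩ := exists_norm_J_le hn
    have hn0 : (1 : ℝ) < n := by exact_mod_cast hn2
    have hexp : 0 < (1 - 1 / n : ℝ) := by
      rw [sub_pos, div_lt_one (by linarith)]
      exact hn0
    set P := ∏ j ∈ Finset.univ.erase k, ‖z j‖ ^ (-(1 / n) : ℝ) with hP
    have hpow : Tendsto (fun w : ℂ => ‖w‖ ^ (1 - 1 / n : ℝ)) (𝓝[≠] 0) (𝓝 0) := by
      have := hnorm.rpow_const (p := (1 - 1 / n : ℝ)) (Or.inr hexp.le)
      rwa [Real.zero_rpow hexp.ne'] at this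
    have hsum : Tendsto (fun w : ℂ => ∑ j, Function.update z k w j) (𝓝[≠] 0)
        (𝓝 (∑ j, Function.update z k 0 j)) := by
      refine tendsto_finsetSum _ fun j _ => ?_
      have : Continuous fun w : ℂ => Function.update z k w j := by fun_prop
      exact (this.tendsto 0).mono_left nhdsWithin_le_nhds
    have hR : Tendsto (fun w : ℂ => C * (‖∑ j, Function.update z k w j‖ * P) *
        ‖w‖ ^ (1 - 1 / n : ℝ)) (𝓝[≠] 0) (𝓝 0) := by
      simpa using (((hsum.norm.mul_const P).const_mul C).mul hpow)
    refine squeeze_zero' (Eventually.of_forall fun w => by positivity) ?_ hR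
    filter_upwards [self_mem_nhdsWithin] with w hw
    have hw0 : 0 < ‖w‖ := norm_pos_iff.2 hw
    have h1 := hC _ (update_mem_torus hz k hw)
    have h2 : ∏ j, ‖Function.update z k w j‖ ^ (-(1 / n) : ℝ) = ‖w‖ ^ (-(1 / n) : ℝ) * P := by
      rw [← Finset.mul_prod_erase _ _ (Finset.mem_univ k), Function.update_self, hP]
      congr 1
      refine Finset.prod_congr rfl fun j hj => ?_
      rw [Function.update_of_ne (Finset.ne_of_mem_erase hj)]
    have h3 : ‖w‖ ^ (1 - 1 / n : ℝ) = ‖w‖ ^ (-(1 / n) : ℝ) * ‖w‖ := by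
      rw [sub_eq_neg_add, Real.rpow_add hw0, Real.rpow_one]
    rw [h2] at h1
    rw [h3]
    calc _ ≤ _ := mul_le_mul_of_nonneg_right h1 hw0.le
      _ = _ := by ring

/-! ### Homogeneity -/

theorem rayIntegrand_smul {n : ℕ} (hn : 1 ≤ n) (z : Fin n → ℂ) {c : ℂ} (hc : c ≠ 0) (r : Fin n → ℝ) :
    rayIntegrand n (c • z) r = c⁻¹ * rayIntegrand n z r := by
  have e1 : ∀ j, rayPoint ((c • z) j) (r j) = c * rayPoint (z j) (r j) := fun j => by
    simp [rayPoint]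
    ring
  have e2 : ∀ t t' : ℂ, c * t * (c * t') / (c * t' - c * t) = c * (t * t' / (t' - t)) := by
    intro t t'
    rw [← mul_sub, mul_mul_mul_comm, mul_assoc, mul_div_mul_left _ _ hc, mul_div_assoc]
  have e3 : ∀ j, exp (-(2 * Real.pi * I) * (c • z) j / (c * rayPoint (z j) (r j))) /
      (c * rayPoint (z j) (r j)) ^ 2 =
      (c ^ 2)⁻¹ * (exp (-(2 * Real.pi * I) * z j / rayPoint (z j) (r j)) / rayPoint (z j) (r j) ^ 2) := by
    intro j
    rw [Pi.smul_apply, smul_eq_mul, mul_left_comm, mul_div_mul_left _ _ hc, mul_pow]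
    field_simp
  have e4 : ∀ j, I * (c • z) j = c * (I * z j) := fun j => by
    simp
    ring
  -- The powers of `c` come from the `dt_j`, from the `t_j⁻²` and from the `n - 1` coupling factors.
  have hcc : c ^ n * ((c ^ 2)⁻¹ ^ n * c ^ (n - 1)) = c⁻¹ := by
    have : c ^ n = c ^ (n - 1) * c := by rw [← pow_succ, Nat.sub_add_cancel hn]
    rw [inv_pow, ← pow_mul, mul_comm 2 n, pow_mul, this]
    field_simp
  simp only [rayIntegrand, kernel, e1, e3, e4, Finset.prod_mul_distrib, Finset.prod_const,
    Finset.card_univ, Fintype.card_fin]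
  have e5 : ∏ i : Fin (n - 1), c * rayPoint (z (lo i)) (r (lo i)) * (c * rayPoint (z (hi i)) (r (hi i))) /
      (c * rayPoint (z (hi i)) (r (hi i)) - c * rayPoint (z (lo i)) (r (lo i))) = c ^ (n - 1) *
      ∏ i : Fin (n - 1), rayPoint (z (lo i)) (r (lo i)) * rayPoint (z (hi i)) (r (hi i)) /
      (rayPoint (z (hi i)) (r (hi i)) - rayPoint (z (lo i)) (r (lo i))) := by
    rw [← Fin.prod_const, ← Finset.prod_mul_distrib]
    exact Finset.prod_congr rfl fun i _ => e2 _ _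
  have key : ∀ A B C D A' B' : ℂ, A * B * (A' * C * (B' * D)) = A * (A' * B') * (B * (C * D)) :=
    fun _ _ _ _ _ _ => by ring
  rw [e5, key, hcc]

theorem rayJ_smul {n : ℕ} (hn : 1 ≤ n) (z : Fin n → ℂ) {c : ℂ} (hc : c ≠ 0) :
    rayJ n (c • z) = rayJ n z := by
  simp only [rayJ, rayIntegrand_smul hn z hc, integral_const_mul, Pi.smul_apply, smul_eq_mul,
    ← Finset.mul_sum]
  field_simp

theorem J_smul {n : ℕ} (hn : 1 ≤ n) (z : Fin n → ℂ) {c : ℂ} (hc : c ≠ 0) :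
    J n (c • z) = J n z := by
  have h1 : ∀ τ ε, tilt n (c • z) τ ε = c • tilt n z τ ε := by
    intro τ ε
    funext j
    simp [tilt, mul_assoc]
  simp only [J_eq_wallJ hn, wallJ, h1, rayJ_smul hn _ hc]

/-! ### The recursion -/

theorem dHead_apply {n : ℕ} (k : Fin (n - 1)) (v : Fin n → ℂ) : dHead k v = ∑ i, head k v i := by
  simp [dHead, head]

theorem dTail_apply {n : ℕ} (k : Fin (n - 1)) (v : Fin n → ℂ) : dTail k v = ∑ i, tail k v i := by
  simp [dTail, tail]

theorem dHead_add_dTail {n : ℕ} (k : Fin (n - 1)) (v : Fin n → ℂ) :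
    dHead k v + dTail k v = ∑ j, v j := by
  have := k.2
  rw [dHead_apply, dTail_apply, sum_fin_split (n := n) (p := k + 1) (q := n - (k + 1)) (by omega)]
  rfl

theorem dHead_single {n : ℕ} (k : Fin (n - 1)) (m : Fin n) :
    dHead k (Pi.single m 1) = if (m : ℕ) ≤ k then 1 else 0 := by
  rw [dHead_apply]
  simp only [head]
  split_ifs with h
  · rw [Finset.sum_eq_single ⟨m, by omega⟩]
    · simp
    · intro i _ hi
      refine Pi.single_eq_of_ne (fun hm => hi ?_) _
      exact Fin.ext (congrArg (fun x : Fin n => (x : ℕ)) hm)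
    · simp
  · refine Finset.sum_eq_zero fun i _ => Pi.single_eq_of_ne (fun hm => h ?_) _
    have := i.2
    have := congrArg (fun x : Fin n => (x : ℕ)) hm
    simp only at this
    omega

theorem prefactor_mul {n p q : ℕ} (h : p + q = n) :
    prefactor p * prefactor q = 2 * Real.pi * prefactor n := by
  subst h
  simp only [prefactor, pow_add]
  ring

theorem J_exp {n : ℕ} (hn : 1 ≤ n) {a : Fin n → ℂ} (ha : a ∈ lift n) :
    J n (fun j => exp (a j)) =
      prefactor n * (∑ j, exp (a j)) * coreIntegral n a (fun j => exp (a j)) := by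
  rw [J_eq_rayJ (exp_mem_domain ha), rayJ_exp hn]

theorem hasFDerivAt_J {n : ℕ} (hn : 1 ≤ n) {z : Fin n → ℂ} (hz : z ∈ domain n)
    (hden : ∀ k : Fin (n - 1), ∑ i, head k z i ≠ 0 ∧ ∑ i, tail k z i ≠ 0) :
    HasFDerivAt (J n) (recursionForm J n z) z := by
  obtain ⟨a, ha, haz⟩ := exists_lift hn hz
  obtain rfl : (fun j => exp (a j)) = z := funext haz
  set z : Fin n → ℂ := fun j => exp (a j) with hzdef
  obtain ⟨L, hL, hLz, hLgap⟩ :=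
    hasFDerivAt_coreIntegral_right hn (admissible_of_mem_sector (mem_sector_self ha))
  set g : Fin (n - 1) → ℂ := fun k => -(2 * Real.pi) * (coreIntegral (k + 1) (head k a) (head k z) *
    coreIntegral (n - (k + 1)) (tail k a) (tail k z)) with hg
  set K := coreIntegral n a z with hK
  set dS : (Fin n → ℂ) →L[ℂ] ℂ := ∑ j, ContinuousLinearMap.proj (R := ℂ) (φ := fun _ : Fin n => ℂ) j
    with hdS
  have hdS' : ∀ v, dS v = ∑ j, v j := fun v => by simp [hdS]
  have hder : HasFDerivAt (fun z : Fin n → ℂ => prefactor n * (∑ j, z j) * coreIntegral n a z)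
      ((prefactor n * ∑ j, z j) • L + K • prefactor n • dS) z := by
    have h1 : HasFDerivAt (fun z : Fin n → ℂ => prefactor n * ∑ j, z j) (prefactor n • dS) z := by
      have := (dS.hasFDerivAt (x := z)).const_mul (prefactor n)
      simpa only [hdS'] using this
    exact h1.mul hL
  have hJ : HasFDerivAt (J n) ((prefactor n * ∑ j, z j) • L + K • prefactor n • dS) z := by
    refine hder.congr_of_eventuallyEq ?_
    filter_upwards [eventually_rayJ_eq hn ha] with w hw
    rw [J_eq_rayJ hw.1, hw.2]
  refine hJ.congr_fderiv ?_
  -- `dHead k` jumps exactly at the gap `k`, so subtracting `∑ g k • dHead k` removes all jumps of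
  -- `L` and leaves a multiple of `∑ dz_j`.
  obtain ⟨d, hd⟩ := eq_smul_sum_proj hn (L := L - ∑ k, g k • dHead k) (by
    intro k
    have h1 : ∀ m : Fin n, (L - ∑ k, g k • dHead k) (Pi.single m 1) =
        L (Pi.single m 1) - ∑ k' : Fin (n - 1), g k' * (if (m : ℕ) ≤ k' then 1 else 0) := by
      intro m
      simp [dHead_single]
    rw [h1, h1, sub_eq_sub_iff_sub_eq_sub, hLgap k, ← Finset.sum_sub_distrib]
    rw [Finset.sum_eq_single k]
    · simp [hg]
      rfl
    · intro k' _ hk'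
      have : (k' : ℕ) ≠ k := fun h => hk' (Fin.ext h)
      rw [← mul_sub]
      split_ifs with h1 h2 h2
      · simp
      · simp only at h1 h2; omega
      · simp only at h1 h2; omega
      · simp
    · simp)
  have hLv : ∀ v, L v = ∑ k, g k * dHead k v + d * ∑ j, v j := by
    intro v
    have := hd v
    simp only [_root_.sub_apply, _root_.sum_apply,
      _root_.smul_apply, smul_eq_mul] at this
    linear_combination this
  have hKz : -K = ∑ k, g k * dHead k z + d * ∑ j, z j := by rw [← hLv, hLz]
  ext1 v
  -- The unknown `d` is eliminated by Euler's relation `hKz`, without dividing by `∑ z_j`.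
  have hlhs : ((prefactor n * ∑ j, z j) • L + K • prefactor n • dS) v =
      prefactor n * ∑ k, g k * (dTail k z * dHead k v - dHead k z * dTail k v) := by
    have e : ∀ k, g k * (dTail k z * dHead k v - dHead k z * dTail k v) =
        (∑ j, z j) * (g k * dHead k v) - (∑ j, v j) * (g k * dHead k z) := by
      intro k
      rw [← dHead_add_dTail k z, ← dHead_add_dTail k v]
      ring
    simp only [e, Finset.sum_sub_distrib, ← Finset.mul_sum]
    simp only [_root_.add_apply, _root_.smul_apply, smul_eq_mul, hdS', hLv]
    linear_combination -(prefactor n) * (∑ j, v j) * hKz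
  rw [hlhs, recursionForm, _root_.sum_apply, Finset.mul_sum]
  refine Finset.sum_congr rfl fun k _ => ?_
  have hk := k.2
  have hH : J (k + 1) (head k z) = prefactor (k + 1) * dHead k z *
      coreIntegral (k + 1) (head k a) (head k z) := by
    rw [dHead_apply]
    exact J_exp (by omega) (head_mem_lift ha k)
  have hT : J (n - (k + 1)) (tail k z) = prefactor (n - (k + 1)) * dTail k z *
      coreIntegral (n - (k + 1)) (tail k a) (tail k z) := by
    rw [dTail_apply]
    exact J_exp (by omega) (tail_mem_lift ha k)
  have hp := prefactor_mul (p := k + 1) (q := n - (k + 1)) (n := n) (by omega)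
  obtain ⟨h1, h2⟩ := hden k
  rw [← dHead_apply] at h1
  rw [← dTail_apply] at h2
  rw [hH, hT]
  simp only [_root_.sub_apply, _root_.smul_apply, smul_eq_mul,
    ← dHead_apply, ← dTail_apply, hg]
  have key : ∀ p q P A B H T h t : ℂ, H ≠ 0 → T ≠ 0 → p * q = 2 * Real.pi * P →
      P * (-(2 * Real.pi) * (A * B) * (T * h - H * t)) =
        p * H * A * (q * T * B) * (T⁻¹ * t - H⁻¹ * h) := by
    intro p q P A B H T h t hH hT hpq
    have : p * H * A * (q * T * B) * (T⁻¹ * t - H⁻¹ * h) = (p * q) * (A * B) * (H * t - T * h) := by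
      field_simp
    rw [this, hpq]
    ring
  exact key _ _ _ _ _ _ _ _ _ h1 h2 hp

/-! ### Symmetrization -/

/-- The alternating rational identity: the product over a path is a difference of its end points
times the product over the closed cycle. -/
theorem sum_perm_prod_one_div_sub {n : ℕ} (hn : 2 ≤ n) {u : Fin n → ℂ} (hu : Function.Injective u) :
    ∑ σ : Equiv.Perm (Fin n), ∏ i : Fin (n - 1), 1 / (u (σ (lo i)) - u (σ (hi i))) = 0 := by
  obtain ⟨m, rfl⟩ : ∃ m, n = m + 1 + 1 := ⟨n - 2, by omega⟩
  set C : Equiv.Perm (Fin (m + 1 + 1)) → ℂ := fun σ => ∏ i, (u (σ i) - u (σ (finRotate _ i)))⁻¹ with hC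
  have hpath : ∀ σ : Equiv.Perm (Fin (m + 1 + 1)),
      ∏ i : Fin (m + 1 + 1 - 1), 1 / (u (σ (lo i)) - u (σ (hi i))) =
        u (σ (Fin.last (m + 1))) * C σ - u (σ (finRotate _ (Fin.last (m + 1)))) * C σ := by
    intro σ
    have hne : u (σ (Fin.last (m + 1))) - u (σ (finRotate _ (Fin.last (m + 1)))) ≠ 0 := by
      rw [sub_ne_zero]
      intro h
      have := σ.injective (hu h)
      rw [finRotate_last, Fin.ext_iff] at this
      simp at this
    rw [← sub_mul, hC]
    simp only
    rw [Fin.prod_univ_castSucc, mul_comm (∏ i : Fin (m + 1), _), mul_inv_cancel_left₀ hne]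
    change ∏ i : Fin (m + 1), 1 / (u (σ i.castSucc) - u (σ i.succ)) = _
    refine Finset.prod_congr rfl fun i _ => ?_
    have hi : finRotate (m + 1 + 1) i.castSucc = i.succ := by
      rw [finRotate_apply, Fin.coeSucc_eq_succ]
    rw [one_div, hi]
  have hrot : ∀ σ, C (σ * finRotate (m + 1 + 1)) = C σ := by
    intro σ
    simp only [hC, Equiv.Perm.mul_apply]
    exact Equiv.prod_comp (finRotate (m + 1 + 1)) fun i => (u (σ i) - u (σ (finRotate _ i)))⁻¹
  simp only [hpath]
  -- Rotating the cycle fixes `C` and carries the last vertex to the first, so the two sums agree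
  -- after reindexing.
  rw [Finset.sum_sub_distrib, sub_eq_zero,
    ← Equiv.sum_comp (Equiv.mulRight (finRotate (m + 1 + 1)))
      (fun σ : Equiv.Perm (Fin (m + 1 + 1)) => u (σ (Fin.last (m + 1))) * C σ)]
  simp only [Equiv.coe_mulRight, hrot, Equiv.Perm.mul_apply]

theorem eventually_tilt_comp_mem_domain {n : ℕ} (hn : 1 ≤ n) {z : Fin n → ℂ} (hz : z ∈ torus n)
    (τ : Equiv.Perm (Fin n)) :
    ∀ᶠ ε in 𝓝[>] (0 : ℝ), ∀ σ : Equiv.Perm (Fin n), tilt n z τ ε ∘ σ ∈ domain n :=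
  eventually_all.2 fun σ =>
    eventually_tilt_mem_domain hn (z := z ∘ σ) (fun j => hz (σ j)) (τ * σ)

theorem measurePreserving_comp_perm {n : ℕ} (σ : Equiv.Perm (Fin n)) :
    MeasurePreserving (fun r : Fin n → ℝ => r ∘ σ) ∧
      MeasurableEmbedding (fun r : Fin n → ℝ => r ∘ σ) := by
  have h : (fun r : Fin n → ℝ => r ∘ σ) = MeasurableEquiv.piCongrLeft (fun _ : Fin n => ℝ) σ.symm := by
    funext r j
    have := Equiv.piCongrLeft_apply_apply (fun _ : Fin n => ℝ) σ.symm r (σ j)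
    rw [Equiv.symm_apply_apply] at this
    exact this.symm
  rw [h]
  exact ⟨volume_measurePreserving_piCongrLeft (fun _ : Fin n => ℝ) σ.symm,
    MeasurableEquiv.measurableEmbedding _⟩

theorem preimage_orthant_comp_perm {n : ℕ} (σ : Equiv.Perm (Fin n)) :
    (fun r : Fin n → ℝ => r ∘ σ) ⁻¹' orthant n = orthant n := by
  ext r
  exact ⟨fun h j => by simpa using h (σ.symm j), fun h j => h (σ j)⟩

theorem exists_perm_lo_hi {n : ℕ} (k : Fin (n - 1)) {i j : Fin n} (hij : i ≠ j) :
    ∃ σ : Equiv.Perm (Fin n), σ (lo k) = i ∧ σ (hi k) = j := by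
  have hne : lo k ≠ hi k := fun h => by
    have := congrArg (fun x : Fin n => (x : ℕ)) h
    simp at this
  set e := Equiv.swap (lo k) i with he
  have h1 : e (lo k) = i := Equiv.swap_apply_left _ _
  refine ⟨Equiv.swap (e (hi k)) j * e, ?_, ?_⟩
  · rw [Equiv.Perm.mul_apply, h1]
    refine Equiv.swap_apply_of_ne_of_ne (fun h => hne ?_) hij
    exact e.injective (h1.trans h)
  · rw [Equiv.Perm.mul_apply, Equiv.swap_apply_left]

/-- The coupling factors are `1 / (t_k⁻¹ - t_{k+1}⁻¹)` and everything else is symmetric, so the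
rational identity applies. The `t_j` are distinct because some permutation makes any two indices
consecutive. -/
theorem sum_rayIntegrand_perm {n : ℕ} (hn : 2 ≤ n) {z : Fin n → ℂ}
    (hz : ∀ σ : Equiv.Perm (Fin n), z ∘ σ ∈ domain n) {r : Fin n → ℝ} (hr : r ∈ orthant n) :
    ∑ σ : Equiv.Perm (Fin n), rayIntegrand n (z ∘ σ) (r ∘ σ) = 0 := by
  set t : Fin n → ℂ := fun j => rayPoint (z j) (r j) with ht
  have hz0 : ∀ j, z j ≠ 0 := fun j => (hz 1).1 j
  have ht0 : ∀ j, t j ≠ 0 := fun j =>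
    mul_ne_zero (mul_ne_zero I_ne_zero (hz0 j)) (by exact_mod_cast (hr j).ne')
  have hinj : Function.Injective fun j => (t j)⁻¹ := by
    intro i j hij
    by_contra hne
    obtain ⟨σ, h1, h2⟩ := exists_perm_lo_hi (⟨0, by omega⟩ : Fin (n - 1)) hne
    refine (hz σ).2 ⟨0, by omega⟩ ⟨r i / r j, div_nonneg (hr i).le (hr j).le, ?_⟩
    change z (σ (hi ⟨0, _⟩)) / z (σ (lo ⟨0, _⟩)) = _
    rw [h1, h2]
    have h3 : I * z i * r i = I * z j * r j := inv_injective hij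
    have h4 : z i * r i = z j * r j := by
      rw [mul_assoc, mul_assoc] at h3
      exact mul_left_cancel₀ I_ne_zero h3
    have hrj : (r j : ℂ) ≠ 0 := by exact_mod_cast (hr j).ne'
    rw [ofReal_div, div_eq_div_iff (hz0 i) hrj, ← h4, mul_comm]
  have hterm : ∀ σ : Equiv.Perm (Fin n), rayIntegrand n (z ∘ σ) (r ∘ σ) =
      ((∏ j, I * z j) * ∏ j, exp (-(2 * Real.pi * I) * z j / t j) / t j ^ 2) *
        ∏ i : Fin (n - 1), 1 / ((t (σ (lo i)))⁻¹ - (t (σ (hi i)))⁻¹) := by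
    intro σ
    have h1 : ∏ j, I * (z ∘ σ) j = ∏ j, I * z j := Equiv.prod_comp σ fun j => I * z j
    have h2 : ∏ j, exp (-(2 * Real.pi * I) * (z ∘ σ) j / t (σ j)) / t (σ j) ^ 2 =
        ∏ j, exp (-(2 * Real.pi * I) * z j / t j) / t j ^ 2 :=
      Equiv.prod_comp σ fun j => exp (-(2 * Real.pi * I) * z j / t j) / t j ^ 2
    have h3 : ∀ x y : ℂ, x ≠ 0 → y ≠ 0 → x * y / (y - x) = 1 / (x⁻¹ - y⁻¹) := by
      intro x y hx hy
      rw [inv_sub_inv hx hy, one_div_div]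
    have h4 : ∏ i : Fin (n - 1), t (σ (lo i)) * t (σ (hi i)) / (t (σ (hi i)) - t (σ (lo i))) =
        ∏ i : Fin (n - 1), 1 / ((t (σ (lo i)))⁻¹ - (t (σ (hi i)))⁻¹) :=
      Finset.prod_congr rfl fun i _ => h3 _ _ (ht0 _) (ht0 _)
    rw [rayIntegrand, kernel, h1, ← h2, ← h4]
    exact (mul_assoc _ _ _).symm
  simp only [hterm]
  rw [← Finset.mul_sum, sum_perm_prod_one_div_sub hn hinj, mul_zero]

theorem sum_rayJ_perm {n : ℕ} (hn : 2 ≤ n) {z : Fin n → ℂ}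
    (hz : ∀ σ : Equiv.Perm (Fin n), z ∘ σ ∈ domain n) :
    ∑ σ : Equiv.Perm (Fin n), rayJ n (z ∘ σ) = 0 := by
  have hint : ∀ σ : Equiv.Perm (Fin n), IntegrableOn (fun r => rayIntegrand n (z ∘ σ) (r ∘ σ)) (orthant n) := by
    intro σ
    obtain ⟨a, ha, haz⟩ := exists_lift (by omega) (hz σ)
    have h1 := integrableOn_rayIntegrand (by omega) ha
    have h2 := (measurePreserving_comp_perm σ).1.integrableOn_comp_preimage
      (measurePreserving_comp_perm σ).2 (f := rayIntegrand n (z ∘ σ)) (s := orthant n)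
    rw [preimage_orthant_comp_perm] at h2
    refine h2.2 ?_
    rwa [show (fun j => exp (a j)) = z ∘ σ from funext haz] at h1
  have hJ : ∀ σ : Equiv.Perm (Fin n), rayJ n (z ∘ σ) = (∑ i, z i) / (2 * Real.pi * I) ^ (n - 1) *
      ∫ r in orthant n, rayIntegrand n (z ∘ σ) (r ∘ σ) := by
    intro σ
    have h2 := (measurePreserving_comp_perm σ).1.setIntegral_preimage_emb
      (measurePreserving_comp_perm σ).2 (rayIntegrand n (z ∘ σ)) (orthant n)
    rw [preimage_orthant_comp_perm] at h2
    rw [rayJ, ← h2]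
    congr 2
    exact Equiv.sum_comp σ z
  have hm : MeasurableSet (orthant n) := by
    simp only [orthant]
    measurability
  simp only [hJ]
  rw [← Finset.mul_sum, ← integral_finsetSum _ fun σ _ => hint σ,
    setIntegral_congr_fun hm fun r hr => sum_rayIntegrand_perm hn hz hr]
  simp

theorem sum_J_perm {n : ℕ} (hn : 2 ≤ n) {z : Fin n → ℂ} (hz : z ∈ torus n) :
    ∑ σ : Equiv.Perm (Fin n), J n (z ∘ σ) = 0 := by
  have hn1 : 1 ≤ n := by omega
  set l : Equiv.Perm (Fin n) → Equiv.Perm (Fin n) → ℂ := fun τ σ =>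
    limUnder (𝓝[>] (0 : ℝ)) fun ε => rayJ n (tilt n z τ ε ∘ σ) with hl
  -- Tilting `z ∘ σ` by `τ * σ` is tilting `z` by `τ` and then permuting. The average over all tilts
  -- thus decouples `τ` from `σ`, and for fixed `τ` the sum over `σ` vanishes before the limit.
  have h1 : ∀ σ : Equiv.Perm (Fin n), J n (z ∘ σ) = (∑ τ, l τ σ) / (n.factorial : ℂ) := by
    intro σ
    rw [J_eq_wallJ hn1, wallJ, ← Equiv.sum_comp (Equiv.mulRight σ)]
    rfl
  have h2 : ∀ τ, ∑ σ, l τ σ = 0 := by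
    intro τ
    have h3 : Tendsto (fun ε => ∑ σ : Equiv.Perm (Fin n), rayJ n (tilt n z τ ε ∘ σ)) (𝓝[>] (0 : ℝ))
        (𝓝 (∑ σ, l τ σ)) :=
      tendsto_finsetSum _ fun σ _ =>
        tendsto_rayJ_tilt hn1 (z := z ∘ σ) (fun j => hz (σ j)) (τ * σ)
    refine tendsto_nhds_unique h3 (tendsto_const_nhds.congr' ?_)
    filter_upwards [eventually_tilt_comp_mem_domain hn1 hz τ] with ε hε
    exact (sum_rayJ_perm hn hε).symm
  simp only [h1]
  rw [← Finset.sum_div, Finset.sum_comm]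
  simp [h2]

theorem isJoyceFamily_J : IsJoyceFamily J where
  homogeneous _ hn z _ _ hc := J_smul hn z hc
  holomorphic n hn z hz := by
    refine DifferentiableAt.differentiableWithinAt ((differentiableAt_rayJ hn hz).congr_of_eventuallyEq ?_)
    filter_upwards [(isOpen_domain hn).mem_nhds hz] with w hw using J_eq_rayJ hw
  initial _ hz := J_one hz
  recursion _ hn _ hz hden := hasFDerivAt_J hn hz hden
  symmetrization _ hn _ hz := sum_J_perm hn hz
  growth _ hn _ hz k := J_isLittleO hn hz k

/-! ### Uniqueness -/

theorem isPreconnected_domain {n : ℕ} (hn : 1 ≤ n) : IsPreconnected (domain n) := by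
  have h1 : domain n = (fun (a : Fin n → ℂ) j => exp (a j)) '' lift n := by
    ext z
    constructor
    · intro hz
      obtain ⟨a, ha, haz⟩ := exists_lift hn hz
      exact ⟨a, ha, funext haz⟩
    · rintro ⟨a, ha, rfl⟩
      exact exp_mem_domain ha
  rw [h1]
  exact (convex_lift n).isPreconnected.image _ (by fun_prop)

theorem head_mem_domain {n : ℕ} {z : Fin n → ℂ} (hz : z ∈ domain n) (k : Fin (n - 1)) :
    head k z ∈ domain (k + 1) :=
  ⟨fun _ => hz.1 _, fun i => hz.2 ⟨i, by omega⟩⟩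

theorem tail_mem_domain {n : ℕ} {z : Fin n → ℂ} (hz : z ∈ domain n) (k : Fin (n - 1)) :
    tail k z ∈ domain (n - (k + 1)) :=
  ⟨fun _ => hz.1 _, fun i => hz.2 ⟨k + 1 + i, by omega⟩⟩

theorem eventually_add_mul_ne_zero (a : ℂ) {m : ℂ} (hm : m ≠ 0) :
    ∀ᶠ ε : ℂ in 𝓝[≠] 0, a + ε * m ≠ 0 := by
  rcases eq_or_ne a 0 with rfl | ha
  · filter_upwards [self_mem_nhdsWithin] with ε hε
    simpa [hm] using hε
  · have hc : ContinuousAt (fun ε : ℂ => a + ε * m) 0 := by fun_prop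
    exact nhdsWithin_le_nhds (hc.eventually_ne (by simpa using ha))

/-- The denominators of the recursion do not vanish. -/
def denominatorsNeZero (n : ℕ) : Set (Fin n → ℂ) :=
  {z | ∀ k : Fin (n - 1), ∑ i, head k z i ≠ 0 ∧ ∑ i, tail k z i ≠ 0}

theorem isOpen_denominatorsNeZero (n : ℕ) : IsOpen (denominatorsNeZero n) := by
  simp only [denominatorsNeZero, Set.ofPred_forall, Set.ofPred_and, ← dHead_apply, ← dTail_apply]
  exact isOpen_iInter_of_finite fun k =>
    (isOpen_ne_fun (dHead k).continuous continuous_const).inter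
      (isOpen_ne_fun (dTail k).continuous continuous_const)

/-- A shift by `ε (1, …, 1)` changes each partial sum by a positive integer multiple of `ε`, so
small `ε ≠ 0` avoid all zeros. -/
theorem exists_mem_denominatorsNeZero {n : ℕ} {z : Fin n → ℂ} {s : Set (Fin n → ℂ)}
    (hs : s ∈ 𝓝 z) : ∃ p ∈ s, p ∈ denominatorsNeZero n := by
  have h1 : ∀ᶠ ε : ℂ in 𝓝[≠] 0, (fun j => z j + ε) ∈ denominatorsNeZero n := by
    refine eventually_all.2 fun k => ?_
    have hk := k.2
    have e1 : ∀ ε : ℂ, ∑ i, head k (fun j => z j + ε) i = ∑ i, head k z i + ε * ((k : ℕ) + 1 : ℕ) := by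
      intro ε
      simp [head, Finset.sum_add_distrib, mul_comm]
    have e2 : ∀ ε : ℂ, ∑ i, tail k (fun j => z j + ε) i =
        ∑ i, tail k z i + ε * (n - ((k : ℕ) + 1) : ℕ) := by
      intro ε
      simp [tail, Finset.sum_add_distrib, mul_comm]
    simp only [e1, e2]
    exact (eventually_add_mul_ne_zero _ (Nat.cast_ne_zero.2 (by omega))).and
      (eventually_add_mul_ne_zero _ (Nat.cast_ne_zero.2 (by omega)))
  have h2 : ∀ᶠ ε : ℂ in 𝓝[≠] 0, (fun j => z j + ε) ∈ s := by
    have hc : ContinuousAt (fun (ε : ℂ) j => z j + ε) 0 := by fun_prop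
    refine nhdsWithin_le_nhds (hc.eventually_mem ?_)
    simpa using hs
  obtain ⟨ε, h3, h4⟩ := (h2.and h1).exists
  exact ⟨_, h3, h4⟩

/-- A holomorphic function on a ball whose derivative vanishes near one point is constant. -/
theorem eq_of_hasFDerivAt_zero_near {E : Type*} [NormedAddCommGroup E] [NormedSpace ℂ E] {f : E → ℂ}
    {z₀ p q : E} {r : ℝ} (hf : DifferentiableOn ℂ f (Metric.ball z₀ r)) (hp : p ∈ Metric.ball z₀ r)
    (hq : q ∈ Metric.ball z₀ r) (h0 : ∀ᶠ x in 𝓝 p, HasFDerivAt f (0 : E →L[ℂ] ℂ) x) : f q = f p := by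
  let _ : NormedSpace ℝ E := NormedSpace.restrictScalars ℝ ℂ E
  -- On the complex line through `p` and `q` the one-variable identity theorem applies; its preimage
  -- of the ball is convex.
  set γ : ℂ → E := fun t => p + t • (q - p) with hγ
  have hγc : Continuous γ := by fun_prop
  have hγ0 : γ 0 = p := by simp [hγ]
  have hγ1 : γ 1 = q := by simp [hγ]
  set Ω : Set ℂ := γ ⁻¹' Metric.ball z₀ r with hΩ
  have hΩo : IsOpen Ω := Metric.isOpen_ball.preimage hγc
  have hΩc : Convex ℝ Ω := by
    intro x hx y hy s t hs ht hst
    have := (convex_ball z₀ r) hx hy hs ht hst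
    have e : γ (s • x + t • y) = s • γ x + t • γ y := by
      obtain rfl : t = 1 - s := by linarith
      simp only [hγ, smul_add, add_smul, sub_smul, one_smul, smul_assoc]
      abel
    change γ (s • x + t • y) ∈ Metric.ball z₀ r
    rw [e]
    exact this
  have hγd : Differentiable ℂ γ := by fun_prop
  have hg : DifferentiableOn ℂ (f ∘ γ) Ω := hf.comp hγd.differentiableOn (fun x hx => hx)
  have hconst : f ∘ γ =ᶠ[𝓝 0] fun _ => f p := by
    obtain ⟨δ, hδ, hball⟩ := Metric.eventually_nhds_iff_ball.1 h0
    have h1 : ∀ᶠ t in 𝓝 (0 : ℂ), γ t ∈ Metric.ball p δ :=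
      hγc.continuousAt.eventually_mem (by rw [hγ0]; exact Metric.ball_mem_nhds _ hδ)
    filter_upwards [h1] with t ht
    have := (convex_ball p δ).norm_image_sub_le_of_norm_hasFDerivWithin_le (𝕜 := ℂ) (C := 0)
      (fun x hx => (hball x hx).hasFDerivWithinAt) (fun x _ => by simp) (Metric.mem_ball_self hδ) ht
    simpa [sub_eq_zero] using this
  have h2 := (hg.analyticOnNhd hΩo).eqOn_of_preconnected_of_eventuallyEq analyticOnNhd_const
    hΩc.isPreconnected (show (0 : ℂ) ∈ Ω by rw [hΩ, Set.mem_preimage, hγ0]; exact hp) hconst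
  have h3 := h2 (show (1 : ℂ) ∈ Ω by rw [hΩ, Set.mem_preimage, hγ1]; exact hq)
  simpa [hγ1] using h3

/-- The recursion is silent where a denominator vanishes. Every ball in `D_n` contains a point with
nonzero denominators, from which constancy spreads over the ball, so the derivative vanishes on the
whole connected domain. -/
theorem exists_const_of_recursion {n : ℕ} (hn : 1 ≤ n) {f : (Fin n → ℂ) → ℂ}
    (hf : DifferentiableOn ℂ f (domain n))
    (h0 : ∀ z ∈ domain n, z ∈ denominatorsNeZero n → HasFDerivAt f (0 : (Fin n → ℂ) →L[ℂ] ℂ) z) :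
    ∀ z ∈ domain n, ∀ w ∈ domain n, f z = f w := by
  intro z hz w hw
  refine (isOpen_domain hn).is_const_of_fderiv_eq_zero (𝕜 := ℂ) (isPreconnected_domain hn) hf ?_ hz hw
  intro x hx
  obtain ⟨r, hr, hball⟩ := Metric.isOpen_iff.1 (isOpen_domain hn) x hx
  obtain ⟨p, hp, hpd⟩ := exists_mem_denominatorsNeZero (Metric.ball_mem_nhds x hr)
  have hnear : ∀ᶠ y in 𝓝 p, HasFDerivAt f (0 : (Fin n → ℂ) →L[ℂ] ℂ) y := by
    filter_upwards [(isOpen_domain hn).mem_nhds (hball hp),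
      (isOpen_denominatorsNeZero n).mem_nhds hpd] with y h1 h2 using h0 y h1 h2
  have hconst : f =ᶠ[𝓝 x] fun _ => f p := by
    filter_upwards [Metric.ball_mem_nhds x hr] with y hy
    exact eq_of_hasFDerivAt_zero_near (hf.mono hball) hp hy hnear
  rw [hconst.fderiv_eq]
  simp

theorem IsJoyceFamily.eq_J {G : (n : ℕ) → (Fin n → ℂ) → ℂ} (hG : IsJoyceFamily G) (n : ℕ) :
    1 ≤ n → ∀ z ∈ domain n, G n z = J n z := by
  induction n using Nat.strong_induction_on with
  | _ n ih =>
  intro hn z hz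
  rcases eq_or_lt_of_le hn with rfl | hn2
  · rw [hG.initial z hz.1, J_one hz.1]
  have hJ := isJoyceFamily_J
  have hrec : ∀ w ∈ domain n, recursionForm G n w = recursionForm J n w := by
    intro w hw
    refine Finset.sum_congr rfl fun k _ => ?_
    have hk := k.2
    rw [ih (k + 1) (by omega) (by omega) _ (head_mem_domain hw k),
      ih (n - (k + 1)) (by omega) (by omega) _ (tail_mem_domain hw k)]
  have hconst := exists_const_of_recursion hn (f := fun w => G n w - J n w)
    ((hG.holomorphic n hn).sub (hJ.holomorphic n hn)) (by
      intro w hw hden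
      have := (hG.recursion n hn w hw hden).fun_sub (hJ.recursion n hn w hw hden)
      rwa [hrec w hw, sub_self] at this)
  -- Slightly rotating the entries of `(1, …, 1)` by different angles gives a point whose
  -- permutations all lie in `D_n`.
  have hone : (fun _ => 1 : Fin n → ℂ) ∈ torus n := fun _ => one_ne_zero
  obtain ⟨ε, hε⟩ := (eventually_tilt_comp_mem_domain hn hone 1).exists
  set w := tilt n (fun _ => 1) 1 ε
  have hsum : ∑ σ : Equiv.Perm (Fin n), (G n (w ∘ σ) - J n (w ∘ σ)) = 0 := by
    rw [Finset.sum_sub_distrib, hG.symmetrization n hn2 w (hε 1).1,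
      hJ.symmetrization n hn2 w (hε 1).1, sub_zero]
  have heq : ∀ σ : Equiv.Perm (Fin n), G n (w ∘ σ) - J n (w ∘ σ) = G n z - J n z :=
    fun σ => hconst _ (hε σ) _ hz
  simp only [heq, Finset.sum_const, Finset.card_univ, Fintype.card_perm, Fintype.card_fin,
    nsmul_eq_mul, mul_eq_zero, Nat.cast_eq_zero, n.factorial_ne_zero, false_or] at hsum
  exact sub_eq_zero.1 hsum

end JoyceIntegral

end

theorem mainTheorem3 :
    -- both integrals converge absolutely on `D_n` and define the same function there
    (∀ n : ℕ, 1 ≤ n → ∀ z ∈ JoyceIntegral.domain n,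
      IntegrableOn (JoyceIntegral.rayIntegrand n z) (JoyceIntegral.orthant n) ∧
      IntegrableOn (JoyceIntegral.simplexIntegrand n z) (JoyceIntegral.simplex n) ∧
      JoyceIntegral.J n z = JoyceIntegral.rayJ n z ∧
      JoyceIntegral.J n z = JoyceIntegral.simplexJ n z) ∧
    -- the boundary values that are averaged off `D_n` exist
    (∀ n : ℕ, 1 ≤ n → ∀ z ∈ JoyceIntegral.torus n, ∀ τ : Equiv.Perm (Fin n),
      (∀ᶠ ε in 𝓝[>] (0 : ℝ), JoyceIntegral.tilt n z τ ε ∈ JoyceIntegral.domain n) ∧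
      ∃ l : ℂ, Tendsto (fun ε => JoyceIntegral.rayJ n (JoyceIntegral.tilt n z τ ε))
        (𝓝[>] (0 : ℝ)) (𝓝 l)) ∧
    -- the functions `J_n` satisfy the axioms
    JoyceIntegral.IsJoyceFamily JoyceIntegral.J ∧
    -- the rational identity behind the vanishing of the symmetrization
    (∀ n : ℕ, 2 ≤ n → ∀ u : Fin n → ℂ, Function.Injective u →
      ∑ σ : Equiv.Perm (Fin n), ∏ i : Fin (n - 1),
        1 / (u (σ ⟨i, by omega⟩) - u (σ ⟨i + 1, by omega⟩)) = 0) ∧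
    -- every family that satisfies the axioms agrees with `J_n` on `D_n`
    (∀ G : (n : ℕ) → (Fin n → ℂ) → ℂ, JoyceIntegral.IsJoyceFamily G →
      ∀ n : ℕ, 1 ≤ n → ∀ z ∈ JoyceIntegral.domain n, G n z = JoyceIntegral.J n z) := by
  refine ⟨fun n hn z hz => ?_, fun n hn z hz τ => ⟨?_, ?_⟩, JoyceIntegral.isJoyceFamily_J,
    fun n hn u hu => JoyceIntegral.sum_perm_prod_one_div_sub hn hu,
    fun G hG n hn z hz => hG.eq_J n hn z hz⟩
  · obtain ⟨a, ha, haz⟩ := JoyceIntegral.exists_lift hn hz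
    obtain rfl : (fun j => exp (a j)) = z := funext haz
    exact ⟨JoyceIntegral.integrableOn_rayIntegrand hn ha,
      (JoyceIntegral.integrableOn_simplexIntegrand_and_integral hn ha).1,
      JoyceIntegral.J_eq_rayJ hz,
      (JoyceIntegral.J_eq_rayJ hz).trans (JoyceIntegral.rayJ_exp_eq_simplexJ hn ha)⟩
  · exact JoyceIntegral.eventually_tilt_mem_domain hn hz τ
  · exact JoyceIntegral.exists_tendsto_rayJ_tilt hn hz τ
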